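/- Let $n\ge 0$. For a complex vector space $V$ let $V((\lambda))$ be the space of formal Laurent series in $\lambda$ with finite principal part and coefficients in $V$, a vector space over the field $\mathbb C((\lambda))$; complex conjugation, restriction, integration and so on act coefficientwise, with $\bar\lambda=\lambda$. Let $T^*\mathbb R^n$ have coordinates $(q,p)$, let $\pi:T^*\mathbb R^n\to\mathbb R^n$, $\pi(q,p)=q$, be the projection and $i:\mathbb R^n\to T^*\mathbb R^n$, $i(q)=(q,0)$, the zero section. Let $*$ be the Weyl star product on $C^\infty(T^*\mathbb R^n)((\lambda))$, $$f*g=\sum_{r\ge0}\frac{1}{r!}\Big(\frac{i\lambda}{2}\Big)^r M_r(f,g),\qquad M_r(f,g)=\Big(\sum_k\partial_{q^k}\partial_{p'_k}-\partial_{p_k}\partial_{q'^k}\Big)^r f(q,p)\,g(q',p')\Big|_{q'=q,\,p'=p}.$$ Let $\mathcal S=\exp(-\tfrac{i\lambda}{2}\Delta)$ with $\Delta=\sum_k\partial_{q^k}\partial_{p_k}$. Let $C^\infty(T^*\mathbb R^n)_{\mathbb R^n}$ be the space of those $f\in C^\infty(T^*\mathbb R^n)$ (complex valued) for which $\operatorname{supp}(f)\cap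 i(\mathbb R^n)$ is compact, and put $\omega_0(f)=\int_{\mathbb R^n}d^nq\;i^*f$ for $f\in C^\infty(T^*\mathbb R^n)_{\mathbb R^n}((\lambda))$. Let $$J_0=\{f\in C^\infty(T^*\mathbb R^n)_{\mathbb R^n}((\lambda)) : \omega_0(\bar f*f)=0\}$$ be the Gel'fand ideal of $\omega_0$ and $f\mapsto\Psi_f$ the projection of $C^\infty(T^*\mathbb R^n)_{\mathbb R^n}((\lambda))$ onto the quotient by $J_0$. **Theorem.** $J_0$ is a $\mathbb C((\lambda))$-linear subspace, $J_0=\{f\in C^\infty(T^*\mathbb R^n)_{\mathbb R^n}((\lambda)): i^*\mathcal Sf=0\}$, and the following hold. 1. The map $\Phi(\Psi_g)=i^*\mathcal Sg$ is a well-defined $\mathbb C((\lambda))$-linear isomorphism $$\Phi: C^\infty(T^*\mathbb R^n)_{\mathbb R^n}((\lambda))/J_0\longrightarrow \mathcal H_0:=C_0^\infty(\mathbb R^n)((\lambda)),$$ with inverse $\Phi^{-1}(\varphi)=\Psi_{\pi^*\varphi}$. The GNS inner product $\langle\Psi_g,\Psi_h\rangle=\omega_0(\bar g*h)$ is well defined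 on the quotient, and under $\Phi$ it becomes the $L^2$ product: $\langle\Phi^{-1}\varphi,\Phi^{-1}\psi\rangle=\int_{\mathbb R^n}d^nq\;\bar\varphi\psi$ for all $\varphi,\psi\in\mathcal H_0$. 2. $J_0$ is a left ideal of the whole algebra: for all $f\in C^\infty(T^*\mathbb R^n)((\lambda))$ and $g\in J_0$ one has $f*g\in J_0$. Hence $\pi(f)\Psi_g=\Psi_{f*g}$ defines a representation of the unital algebra $(C^\infty(T^*\mathbb R^n)((\lambda)),*)$ on the quotient (that is, $\pi$ is $\mathbb C((\lambda))$-linear, $\pi(1)=1$ and $\pi(f*g)=\pi(f)\pi(g)$). The GNS representation $\pi_0(f)=\Phi\,\pi(f)\,\Phi^{-1}$ on $\mathcal H_0$ is the Schrödinger representation: for all $f\in C^\infty(T^*\mathbb R^n)((\lambda))$ and $\varphi\in\mathcal H_0$, $$\pi_0(f)\varphi=i^*\mathcal S\big(f*(\pi^*\varphi)\big)=\sum_{r=0}^\infty\frac1{r!}\Big(\frac{\lambda}{i}\Big)^r\sum_{i_1,\dots,i_r=1}^n\Big(i^*\frac{\partial^r(\mathcal Sf)}{\partial p_{i_1}\cdots\partial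 p_{i_r}}\Big)\frac{\partial^r\varphi}{\partial q^{i_1}\cdots\partial q^{i_r}}.$$ -/

import Mathlib

open scoped ContDiff TensorProduct ComplexConjugate

noncomputable section

namespace WeylGNS

/-! ### Formal Laurent series with coefficients in a complex vector space -/

/-- The field `ℂ((λ))` of complex Laurent series with finite principal part. -/
def CLaurent : Type := LaurentSeries ℂ

instance : Field CLaurent := inferInstanceAs (Field (LaurentSeries ℂ))

/-- The identification of `ℂ((λ))` with Mathlib's Laurent series. -/
def CLaurent.ofSeries : LaurentSeries ℂ ≃+* CLaurent := RingEquiv.refl _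

/-- `V((λ))`: formal Laurent series in `λ` with finite principal part and coefficients in `V`.
It is a vector space over `ℂ((λ))`. -/
def Laurent (V : Type*) [AddCommGroup V] [Module ℂ V] : Type _ := HahnModule ℤ ℂ V

section Laurent

variable {U V W : Type*} [AddCommGroup U] [Module ℂ U] [AddCommGroup V] [Module ℂ V]
  [AddCommGroup W] [Module ℂ W]

instance : AddCommGroup (Laurent V) := inferInstanceAs (AddCommGroup (HahnModule ℤ ℂ V))

instance : Module CLaurent (Laurent V) :=
  inferInstanceAs (Module (LaurentSeries ℂ) (HahnModule ℤ ℂ V))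

/-- The identification of `V((λ))` with Hahn series over `ℤ`. -/
def toHahn : Laurent V ≃+ HahnSeries ℤ V where
  toFun f := (HahnModule.of ℂ).symm f
  invFun f := HahnModule.of ℂ f
  left_inv _ := rfl
  right_inv _ := rfl
  map_add' _ _ := rfl

/-- The coefficient of `λ ^ k`. -/
def coef (f : Laurent V) (k : ℤ) : V := (toHahn f).coeff k

theorem exists_coef_eq_zero (f : Laurent V) : ∃ m : ℤ, ∀ k < m, coef f k = 0 :=
  ⟨(toHahn f).order, fun _ hk => HahnSeries.coeff_eq_zero_of_lt_order hk⟩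

/-- The Laurent series with prescribed coefficients, which vanish below some degree. -/
def ofCoef (c : ℤ → V) (h : ∃ m : ℤ, ∀ k < m, c k = 0) : Laurent V :=
  toHahn.symm (HahnSeries.ofSuppBddBelow c (by
    obtain ⟨m, hm⟩ := h
    refine ⟨m, fun k hk => ?_⟩
    by_contra hlt
    exact hk (hm k (not_le.mp hlt))))

@[simp] theorem coef_ofCoef (c : ℤ → V) (h) (k : ℤ) : coef (ofCoef c h) k = c k := rfl

/-- Coefficientwise extension of a zero-preserving map. -/
def mapCoef (L : ZeroHom V W) (f : Laurent V) : Laurent W :=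
  toHahn.symm ((toHahn f).map L)

@[simp] theorem coef_mapCoef (L : ZeroHom V W) (f : Laurent V) (k : ℤ) :
    coef (mapCoef L f) k = L (coef f k) := rfl

/-- The operator `∑ r, λ ^ r D_r` on Laurent series. In each degree the sum is finite. -/
def opSeries (D : ℕ → V →ₗ[ℂ] W) (f : Laurent V) : Laurent W :=
  ofCoef (fun k => ∑ᶠ r : ℕ, D r (coef f (k - r))) (by
    obtain ⟨m, hm⟩ := exists_coef_eq_zero f
    refine ⟨m, fun k hk => ?_⟩
    refine finsum_eq_zero_of_forall_eq_zero fun r => ?_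
    rw [hm _ (by omega), map_zero])

/-- The bilinear operation `∑ r, λ ^ r B_r` on Laurent series: the coefficient of `λ ^ k` is
the (finite) sum of `B_r (f_a, g_b)` over `r + a + b = k`. -/
def bilinSeries (B : ℕ → V →ₗ[ℂ] W →ₗ[ℂ] U) (f : Laurent V) (g : Laurent W) : Laurent U :=
  ofCoef (fun k => ∑ᶠ x : ℕ × ℤ, B x.1 (coef f x.2) (coef g (k - x.1 - x.2))) (by
    obtain ⟨m, hm⟩ := exists_coef_eq_zero f
    obtain ⟨m', hm'⟩ := exists_coef_eq_zero g
    refine ⟨m + m', fun k hk => ?_⟩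
    refine finsum_eq_zero_of_forall_eq_zero fun x => ?_
    by_cases h : x.2 < m
    · rw [hm _ h, map_zero, LinearMap.zero_apply]
    · rw [hm' _ (by omega), map_zero])

/-- `P((λ))` as a subspace of `V((λ))`, for a subspace `P` of `V`. -/
def laurentSub (P : Submodule ℂ V) : Submodule CLaurent (Laurent V) where
  carrier := {f | ∀ k, coef f k ∈ P}
  zero_mem' _ := P.zero_mem
  add_mem' hf hg k := P.add_mem (hf k) (hg k)
  smul_mem' c f hf k := by
    change ((HahnModule.of ℂ).symm
      ((CLaurent.ofSeries.symm c) • (show HahnModule ℤ ℂ V from f))).coeff k ∈ P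
    rw [HahnModule.coeff_smul]
    exact P.sum_mem fun x _ => P.smul_mem _ (hf _)

theorem mem_laurentSub {P : Submodule ℂ V} {f : Laurent V} :
    f ∈ laurentSub P ↔ ∀ k, coef f k ∈ P := Iff.rfl

theorem finsum_mem_sub {ι : Type*} (P : Submodule ℂ V) (c : ι → V) (h : ∀ i, c i ∈ P) :
    (∑ᶠ i, c i) ∈ P :=
  finsum_induction (· ∈ P) P.zero_mem (fun _ _ => P.add_mem) h

theorem opSeries_mem (D : ℕ → V →ₗ[ℂ] W) {P : Submodule ℂ V} {Q : Submodule ℂ W}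
    (h : ∀ r, ∀ v ∈ P, D r v ∈ Q) {f : Laurent V} (hf : f ∈ laurentSub P) :
    opSeries D f ∈ laurentSub Q := fun _ =>
  finsum_mem_sub Q _ fun _ => h _ _ (hf _)

theorem bilinSeries_mem (B : ℕ → V →ₗ[ℂ] W →ₗ[ℂ] U) {P : Submodule ℂ W} {Q : Submodule ℂ U}
    (h : ∀ r v, ∀ w ∈ P, B r v w ∈ Q) (f : Laurent V) {g : Laurent W} (hg : g ∈ laurentSub P) :
    bilinSeries B f g ∈ laurentSub Q := fun _ =>
  finsum_mem_sub Q _ fun _ => h _ _ _ (hg _)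

end Laurent

/-! ### Smooth functions and their derivatives -/

/-- The algebra of smooth complex-valued functions on a real normed space. -/
def smoothSubalgebra (E : Type*) [NormedAddCommGroup E] [NormedSpace ℝ E] :
    Subalgebra ℂ (E → ℂ) where
  carrier := {f | ContDiff ℝ ∞ f}
  mul_mem' {f g} hf hg := (show ContDiff ℝ ∞ f from hf).mul (show ContDiff ℝ ∞ g from hg)
  add_mem' {f g} hf hg := (show ContDiff ℝ ∞ f from hf).add (show ContDiff ℝ ∞ g from hg)
  algebraMap_mem' c := show ContDiff ℝ ∞ (fun _ : E => c) from contDiff_const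

/-- `C^∞(E)`, with pointwise operations. -/
def Smooth (E : Type*) [NormedAddCommGroup E] [NormedSpace ℝ E] : Type _ :=
  smoothSubalgebra E

section Smooth

variable {E F : Type*} [NormedAddCommGroup E] [NormedSpace ℝ E]
  [NormedAddCommGroup F] [NormedSpace ℝ F]

instance : CommRing (Smooth E) := inferInstanceAs (CommRing (smoothSubalgebra E))

instance : Algebra ℂ (Smooth E) := inferInstanceAs (Algebra ℂ (smoothSubalgebra E))

instance : Module ℂ (Smooth E) := Algebra.toModule

/-- The underlying function. -/
def Smooth.toFun (f : Smooth E) : E → ℂ := (show smoothSubalgebra E from f).1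

instance : CoeFun (Smooth E) (fun _ => E → ℂ) := ⟨Smooth.toFun⟩

/-- A smooth function as an element of `C^∞(E)`. -/
def Smooth.of (f : E → ℂ) (hf : ContDiff ℝ ∞ f) : Smooth E :=
  show smoothSubalgebra E from ⟨f, hf⟩

@[simp] theorem Smooth.of_apply (f : E → ℂ) (hf) (x : E) : Smooth.of f hf x = f x := rfl

@[ext] theorem Smooth.ext {f g : Smooth E} (h : ∀ x, f x = g x) : f = g :=
  Subtype.ext (funext h)

theorem Smooth.contDiff (f : Smooth E) : ContDiff ℝ ∞ f :=
  (show smoothSubalgebra E from f).2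

@[simp] theorem Smooth.zero_apply (x : E) : (0 : Smooth E) x = 0 := rfl
@[simp] theorem Smooth.one_apply (x : E) : (1 : Smooth E) x = 1 := rfl
@[simp] theorem Smooth.add_apply (f g : Smooth E) (x : E) : (f + g) x = f x + g x := rfl
@[simp] theorem Smooth.mul_apply (f g : Smooth E) (x : E) : (f * g) x = f x * g x := rfl
@[simp] theorem Smooth.smul_apply (c : ℂ) (f : Smooth E) (x : E) : (c • f) x = c * f x := rfl

theorem smooth_differentiable (f : Smooth E) : Differentiable ℝ f :=
  f.contDiff.differentiable (by simp)

/-- The derivative in the direction of the vector `v`. -/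
def pderiv (v : E) : Smooth E →ₗ[ℂ] Smooth E where
  toFun f := Smooth.of (fun x => fderiv ℝ f.toFun x v)
    ((f.contDiff.fderiv_right (m := ∞) (by simp)).clm_apply
      contDiff_const)
  map_add' f g := by
    ext x
    change fderiv ℝ (f.toFun + g.toFun) x v = _
    rw [fderiv_add (smooth_differentiable f x) (smooth_differentiable g x)]
    rfl
  map_smul' c f := by
    ext x
    change fderiv ℝ (c • f.toFun) x v = _
    rw [fderiv_const_smul (smooth_differentiable f x)]
    rfl

/-- Pull-back of smooth functions along a continuous linear map. -/
def pullback (L : E →L[ℝ] F) : Smooth F →ₗ[ℂ] Smooth E where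
  toFun f := Smooth.of (fun x => f.toFun (L x))
    (f.contDiff.comp L.contDiff)
  map_add' _ _ := rfl
  map_smul' _ _ := rfl

/-- Complex conjugation of functions. -/
def conjFun : ZeroHom (Smooth E) (Smooth E) where
  toFun f := Smooth.of (fun x => conj (f.toFun x))
    (Complex.conjCLE.contDiff.comp f.contDiff)
  map_zero' := by
    ext x
    exact map_zero (starRingEnd ℂ)

/-- Complex conjugation on `C^∞(E)((λ))`; the formal parameter `λ` is real. -/
def conjL : Laurent (Smooth E) → Laurent (Smooth E) := mapCoef conjFun

/-- The pointwise product on `C^∞(E)((λ))`. -/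
def mulL (f g : Laurent (Smooth E)) : Laurent (Smooth E) := toHahn.symm (toHahn f * toHahn g)

theorem coef_mulL (f g : Laurent (Smooth E)) (k : ℤ) :
    coef (mulL f g) k =
      ∑ x ∈ Finset.antidiagonal (toHahn f).isPWO_support (toHahn g).isPWO_support k,
        coef f x.1 * coef g x.2 :=
  HahnSeries.coeff_mul

end Smooth

/-! ### Configuration space `ℝⁿ` and phase space `T*ℝⁿ` -/

abbrev Config (n : ℕ) := Fin n → ℝ

/-- `T*ℝⁿ`, with points `(q, p)`. -/
abbrev Phase (n : ℕ) := Config n × Config n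

variable {n : ℕ}

/-- `∂/∂q^k` on phase space. -/
def dq (k : Fin n) : Module.End ℂ (Smooth (Phase n)) := pderiv (Pi.single k 1, 0)

/-- `∂/∂p_k` on phase space. -/
def dp (k : Fin n) : Module.End ℂ (Smooth (Phase n)) := pderiv (0, Pi.single k 1)

/-- `∂/∂q^k` on configuration space. -/
def dconf (k : Fin n) : Module.End ℂ (Smooth (Config n)) := pderiv (Pi.single k 1)

/-- The zero section `i : ℝⁿ → T*ℝⁿ`, `q ↦ (q, 0)`. -/
def zeroSection (n : ℕ) : Config n →L[ℝ] Phase n := ContinuousLinearMap.inl ℝ _ _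

/-- Restriction `i*` to the zero section. -/
def restr : Smooth (Phase n) →ₗ[ℂ] Smooth (Config n) := pullback (zeroSection n)

/-- Pull-back `π*` along the bundle projection `(q, p) ↦ q`. -/
def lift : Smooth (Config n) →ₗ[ℂ] Smooth (Phase n) :=
  pullback (ContinuousLinearMap.fst ℝ (Config n) (Config n))

theorem isClosed_range_zeroSection (n : ℕ) : IsClosed (Set.range (zeroSection n)) := by
  have : Set.range (zeroSection n) = {x : Phase n | x.2 = 0} := by
    ext ⟨q, p⟩
    simp [zeroSection, eq_comm]
  rw [this]
  exact isClosed_eq continuous_snd continuous_const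

/-- `C^∞(T*ℝⁿ)_{ℝⁿ}`: the functions whose support meets the zero section in a compact set. -/
def zeroCompact (n : ℕ) : Submodule ℂ (Smooth (Phase n)) where
  carrier := {f | IsCompact (tsupport f.toFun ∩ Set.range (zeroSection n))}
  zero_mem' := by
    have : tsupport (0 : Smooth (Phase n)).toFun = ∅ :=
      tsupport_eq_empty_iff.mpr rfl
    simp only [Set.mem_ofPred_eq]
    rw [this, Set.empty_inter]
    exact isCompact_empty
  add_mem' {f g} hf hg := by
    have hr := isClosed_range_zeroSection n
    refine (hf.union hg).of_isClosed_subset ((isClosed_tsupport _).inter hr) ?_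
    rw [← Set.union_inter_distrib_right]
    exact Set.inter_subset_inter_left _ (tsupport_add f.toFun g.toFun)
  smul_mem' c f hf := by
    have hr := isClosed_range_zeroSection n
    refine IsCompact.of_isClosed_subset hf ((isClosed_tsupport _).inter hr) ?_
    exact Set.inter_subset_inter_left _
      (tsupport_smul_subset_right (fun _ => c) f.toFun)

/-- `C₀^∞(ℝⁿ)`: smooth functions with compact support. -/
def compactSmooth (n : ℕ) : Submodule ℂ (Smooth (Config n)) where
  carrier := {φ | HasCompactSupport φ.toFun}
  zero_mem' := HasCompactSupport.zero
  add_mem' hf hg := HasCompactSupport.add hf hg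
  smul_mem' c _ hf := HasCompactSupport.smul_left (f := fun _ => c) hf

/-- `C^∞(T*ℝⁿ)((λ))`. -/
abbrev Obs (n : ℕ) := Laurent (Smooth (Phase n))

/-- `C^∞(T*ℝⁿ)_{ℝⁿ}((λ))`. -/
abbrev ObsZ (n : ℕ) : Submodule CLaurent (Obs n) := laurentSub (zeroCompact n)

/-- `C₀^∞(ℝⁿ)((λ))`. -/
abbrev Wave (n : ℕ) : Submodule CLaurent (Laurent (Smooth (Config n))) :=
  laurentSub (compactSmooth n)

/-! ### The Weyl star product and the operator `𝒮` -/

/-- `∑ k, ∂_{q^k} ⊗ ∂_{p_k} - ∂_{p_k} ⊗ ∂_{q^k}` acting on tensors `f ⊗ g`. -/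
def poisson (n : ℕ) : Module.End ℂ (Smooth (Phase n) ⊗[ℂ] Smooth (Phase n)) :=
  ∑ k : Fin n, (TensorProduct.map (dq k) (dp k) - TensorProduct.map (dp k) (dq k))

/-- The bidifferential operator `M_r (f, g) =
(∂_{q^k} ∂_{p'_k} - ∂_{p_k} ∂_{q'^k}) ^ r (f(q,p) g(q',p'))` at `q = q'`, `p = p'`. -/
def moyal (r : ℕ) : Smooth (Phase n) →ₗ[ℂ] Smooth (Phase n) →ₗ[ℂ] Smooth (Phase n) :=
  (TensorProduct.mk ℂ (Smooth (Phase n)) (Smooth (Phase n))).compr₂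
    (LinearMap.mul' ℂ (Smooth (Phase n)) ∘ₗ (poisson n ^ r))

/-- The coefficients `(1 / r!) (i / 2) ^ r M_r` of the Weyl star product. -/
def weylCoef (r : ℕ) : Smooth (Phase n) →ₗ[ℂ] Smooth (Phase n) →ₗ[ℂ] Smooth (Phase n) :=
  ((1 / (r.factorial : ℂ)) * (Complex.I / 2) ^ r) • moyal r

/-- The Weyl star product `f * g = ∑ r, (1 / r!) (i λ / 2) ^ r M_r (f, g)`. -/
def star (f g : Obs n) : Obs n := bilinSeries weylCoef f g

/-- The constant function `1`. -/
def one : Obs n := toHahn.symm 1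

/-- `Δ = ∂² / ∂q^k ∂p_k`. -/
def laplace (n : ℕ) : Module.End ℂ (Smooth (Phase n)) := ∑ k : Fin n, dq k * dp k

/-- The coefficients `(1 / r!) (-i / 2) ^ r Δ ^ r` of `exp (- (i λ / 2) Δ)`. -/
def sCoef (r : ℕ) : Module.End ℂ (Smooth (Phase n)) :=
  ((1 / (r.factorial : ℂ)) * (-Complex.I / 2) ^ r) • laplace n ^ r

/-- `𝒮 = exp (- (i λ / 2) Δ)`. -/
def opS (f : Obs n) : Obs n := opSeries sCoef f

/-! ### Stability of the supports -/

theorem zeroCompact_mono {f g : Smooth (Phase n)} (hg : g ∈ zeroCompact n)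
    (h : tsupport f.toFun ⊆ tsupport g.toFun) : f ∈ zeroCompact n :=
  IsCompact.of_isClosed_subset hg
    ((isClosed_tsupport _).inter (isClosed_range_zeroSection n))
    (Set.inter_subset_inter_left _ h)

theorem pderiv_mem (v : Phase n) {f : Smooth (Phase n)} (hf : f ∈ zeroCompact n) :
    pderiv v f ∈ zeroCompact n :=
  zeroCompact_mono hf (tsupport_fderiv_apply_subset ℝ v)

theorem mul_mem_zeroCompact (f : Smooth (Phase n)) {g : Smooth (Phase n)}
    (hg : g ∈ zeroCompact n) : f * g ∈ zeroCompact n :=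
  zeroCompact_mono hg (tsupport_mul_subset_right (f := f.toFun))

theorem moyal_mem (r : ℕ) (f : Smooth (Phase n)) {g : Smooth (Phase n)}
    (hg : g ∈ zeroCompact n) : moyal r f g ∈ zeroCompact n := by
  let T : Submodule ℂ (Smooth (Phase n) ⊗[ℂ] Smooth (Phase n)) :=
    Submodule.span ℂ {t | ∃ a, ∃ b ∈ zeroCompact n, a ⊗ₜ[ℂ] b = t}
  have hP : T ≤ T.comap (poisson n) := by
    refine Submodule.span_le.mpr ?_
    rintro _ ⟨a, b, hb, rfl⟩
    simp only [Submodule.comap_coe, Set.mem_preimage, SetLike.mem_coe, poisson,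
      LinearMap.sum_apply, LinearMap.sub_apply, TensorProduct.map_tmul]
    refine T.sum_mem fun k _ => T.sub_mem ?_ ?_
    · exact Submodule.subset_span ⟨_, _, pderiv_mem _ hb, rfl⟩
    · exact Submodule.subset_span ⟨_, _, pderiv_mem _ hb, rfl⟩
  have hr : (poisson n ^ r) (f ⊗ₜ[ℂ] g) ∈ T := by
    induction r with
    | zero => exact Submodule.subset_span ⟨f, g, hg, rfl⟩
    | succ r ih =>
      rw [pow_succ']
      exact hP ih
  have hm : T ≤ (zeroCompact n).comap (LinearMap.mul' ℂ (Smooth (Phase n))) := by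
    refine Submodule.span_le.mpr ?_
    rintro _ ⟨a, b, hb, rfl⟩
    exact mul_mem_zeroCompact a hb
  exact hm hr

theorem star_mem (f : Obs n) {g : Obs n} (hg : g ∈ ObsZ n) : star f g ∈ ObsZ n :=
  bilinSeries_mem _ (fun _ v _ hw => (zeroCompact n).smul_mem _ (moyal_mem _ v hw)) f hg

theorem laplace_pow_mem (r : ℕ) {f : Smooth (Phase n)} (hf : f ∈ zeroCompact n) :
    (laplace n ^ r) f ∈ zeroCompact n := by
  induction r with
  | zero => exact hf
  | succ r ih =>
    rw [pow_succ', Module.End.mul_apply]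
    simp only [laplace, LinearMap.sum_apply] at ih ⊢
    exact Submodule.sum_mem _ fun k _ => pderiv_mem _ (pderiv_mem _ ih)

theorem opS_mem {f : Obs n} (hf : f ∈ ObsZ n) : opS f ∈ ObsZ n :=
  opSeries_mem _ (fun r _ hv => (zeroCompact n).smul_mem _ (laplace_pow_mem r hv)) hf

theorem restr_mem {f : Smooth (Phase n)} (hf : f ∈ zeroCompact n) :
    restr f ∈ compactSmooth n := by
  have hc : IsCompact (Prod.fst '' (tsupport f.toFun ∩ Set.range (zeroSection n))) :=
    IsCompact.image hf continuous_fst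
  refine HasCompactSupport.intro hc fun q hq => ?_
  by_contra hne
  exact hq ⟨zeroSection n q, ⟨subset_tsupport _ hne, ⟨q, rfl⟩⟩, rfl⟩

theorem lift_mem {φ : Smooth (Config n)} (hφ : φ ∈ compactSmooth n) :
    lift φ ∈ zeroCompact n := by
  have hc : IsCompact (zeroSection n '' tsupport φ.toFun) :=
    IsCompact.image hφ (zeroSection n).continuous
  refine hc.of_isClosed_subset
    ((isClosed_tsupport _).inter (isClosed_range_zeroSection n)) ?_
  rintro _ ⟨hx, q, rfl⟩
  refine ⟨q, ?_, rfl⟩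
  exact tsupport_comp_subset_preimage φ.toFun continuous_fst hx

theorem pderiv_mem_compactSmooth (v : Config n) {φ : Smooth (Config n)}
    (hφ : φ ∈ compactSmooth n) : pderiv v φ ∈ compactSmooth n :=
  IsCompact.of_isClosed_subset hφ (isClosed_tsupport _) (tsupport_fderiv_apply_subset ℝ v)

theorem mul_mem_compactSmooth (h : Smooth (Config n)) {φ : Smooth (Config n)}
    (hφ : φ ∈ compactSmooth n) : h * φ ∈ compactSmooth n :=
  HasCompactSupport.mul_left (f := h.toFun) hφ

/-! ### The functional `ω₀` and the GNS data -/

/-- The left action `(f, g) ↦ f * g` of the whole algebra on `C^∞(T*ℝⁿ)_{ℝⁿ}((λ))`. -/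
def starZ (f : Obs n) (g : ObsZ n) : ObsZ n := ⟨star f g, star_mem f g.2⟩

/-- `g ↦ i* 𝒮 g`. -/
def restrS (g : ObsZ n) : Wave n :=
  ⟨mapCoef (restr : Smooth (Phase n) →ₗ[ℂ] Smooth (Config n)).toAddMonoidHom.toZeroHom
    (opS (g : Obs n)), fun k => restr_mem (opS_mem g.2 k)⟩

/-- `φ ↦ π* φ`. -/
def liftL (φ : Wave n) : ObsZ n :=
  ⟨mapCoef (lift : Smooth (Config n) →ₗ[ℂ] Smooth (Phase n)).toAddMonoidHom.toZeroHom
    (φ : Laurent (Smooth (Config n))), fun k => lift_mem (φ.2 k)⟩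

/-- Coefficientwise integration `∫ dⁿq φ` over `ℝⁿ`, for compactly supported coefficients. -/
def integral (φ : Wave n) : CLaurent :=
  CLaurent.ofSeries ((toHahn (φ : Laurent (Smooth (Config n)))).map
    (⟨fun ψ => ∫ q, ψ q, by simp⟩ : ZeroHom (Smooth (Config n)) ℂ))

/-- `ω₀ (f) = ∫ dⁿq i* f`. -/
def omega (f : ObsZ n) : CLaurent :=
  integral ⟨mapCoef (restr : Smooth (Phase n) →ₗ[ℂ] Smooth (Config n)).toAddMonoidHom.toZeroHom
    (f : Obs n), fun k => restr_mem (f.2 k)⟩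

/-- The pairing `(f, g) ↦ ω₀ (f̄ * g)` on `C^∞(T*ℝⁿ)_{ℝⁿ}((λ))`. -/
def gnsPairing (f g : ObsZ n) : CLaurent := omega (starZ (conjL (f : Obs n)) g)

/-- The Gel'fand ideal `{f | ω₀ (f̄ * f) = 0}` of `ω₀`, as a set. -/
def gelfandSet (n : ℕ) : Set (ObsZ n) := {f | gnsPairing f f = 0}

/-- The pointwise product `h φ` of Laurent series of functions on `ℝⁿ`. -/
def mulWave (h : Laurent (Smooth (Config n))) (φ : Wave n) : Wave n :=
  ⟨mulL h (φ : Laurent (Smooth (Config n))), fun k => by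
    rw [coef_mulL]
    exact Submodule.sum_mem _ fun x _ => mul_mem_compactSmooth _ (φ.2 x.2)⟩

/-- The `L²` product `⟨φ, ψ⟩ = ∫ dⁿq φ̄ ψ`. -/
def l2 (φ ψ : Wave n) : CLaurent :=
  integral (mulWave (conjL (φ : Laurent (Smooth (Config n)))) ψ)

/-- `∂^r / ∂p_{i_1} … ∂p_{i_r}`. -/
def dpMulti {r : ℕ} (I : Fin r → Fin n) : Module.End ℂ (Smooth (Phase n)) :=
  (List.ofFn fun j => dp (I j)).prod

/-- `∂^r / ∂q^{i_1} … ∂q^{i_r}`. -/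
def dconfMulti {r : ℕ} (I : Fin r → Fin n) : Module.End ℂ (Smooth (Config n)) :=
  (List.ofFn fun j => dconf (I j)).prod

/-- `(h, φ) ↦ (1 / r!) (1 / i) ^ r ∑ i_1 … i_r,
(i* ∂^r h / ∂p_{i_1} … ∂p_{i_r}) (∂^r φ / ∂q^{i_1} … ∂q^{i_r})`. -/
def schrCoef (r : ℕ) : Smooth (Phase n) →ₗ[ℂ] Smooth (Config n) →ₗ[ℂ] Smooth (Config n) :=
  ((1 / (r.factorial : ℂ)) * (1 / Complex.I) ^ r) •
    ∑ I : Fin r → Fin n,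
      (LinearMap.mul ℂ (Smooth (Config n))).compl₁₂ (restr ∘ₗ dpMulti I) (dconfMulti I)

theorem dconfMulti_mem {r : ℕ} (I : Fin r → Fin n) {φ : Smooth (Config n)}
    (hφ : φ ∈ compactSmooth n) : dconfMulti I φ ∈ compactSmooth n := by
  have key : ∀ l : List (Fin n), (l.map dconf).prod φ ∈ compactSmooth n := by
    intro l
    induction l with
    | nil => exact hφ
    | cons k l ih =>
      rw [List.map_cons, List.prod_cons]
      exact pderiv_mem_compactSmooth _ ih
  have h := key (List.ofFn I)
  rw [List.map_ofFn] at h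
  exact h

theorem schrCoef_mem (r : ℕ) (h : Smooth (Phase n)) {φ : Smooth (Config n)}
    (hφ : φ ∈ compactSmooth n) : schrCoef r h φ ∈ compactSmooth n := by
  simp only [schrCoef, LinearMap.smul_apply, LinearMap.sum_apply, LinearMap.compl₁₂_apply]
  exact Submodule.smul_mem _ _ (Submodule.sum_mem _ fun I _ =>
    mul_mem_compactSmooth _ (dconfMulti_mem I hφ))

/-- The Schrödinger series
`∑ r, (1 / r!) (λ / i) ^ r (i* ∂_p^r (𝒮 f)) (∂_q^r φ)`. -/
def schroedinger (f : Obs n) (φ : Wave n) : Wave n :=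
  ⟨bilinSeries schrCoef (opS f) (φ : Laurent (Smooth (Config n))),
    bilinSeries_mem _ (fun r v _ hw => schrCoef_mem r v hw) _ φ.2⟩

end WeylGNS

end

noncomputable section

namespace WeylGNS

open Finset.HasAntidiagonal (antidiagonal)

/-! ### Formal bilinear series and their associativity -/

section LaurentSeries

variable {U V W Z : Type*} [AddCommGroup U] [Module ℂ U] [AddCommGroup V] [Module ℂ V]
  [AddCommGroup W] [Module ℂ W] [AddCommGroup Z] [Module ℂ Z]

/-! Write `μ` for pointwise multiplication. The Weyl product is `μ ∘ exp(λX)` with `X = (i/2) ∑ (∂_q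
⊗ ∂_p - ∂_p ⊗ ∂_q)`. All operators involved have constant coefficients and commute, so composing
such products with exponentials like `𝒮` amounts to adding exponents.

By the Leibniz rule `Δ ∘ μ = μ ∘ (Δ ⊗ 1 + 1 ⊗ Δ + ∑ (∂_q ⊗ ∂_p + ∂_p ⊗ ∂_q))`. Adding exponents
gives `𝒮(f * g) = 𝒮f ⋆ 𝒮g`, where `⋆` is the standard ordered product with generator `(1/i) ∑ ∂_p ⊗
∂_q` (`opS_star`). In `⋆` the right factor is differentiated only along `q`, which is tangent to the
zero section. Hence `i*(F ⋆ G)` depends on `G` only through `i*G`, and `i*𝒮(f * g)` is the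
Schrödinger operator of `f` applied to `i*𝒮g` (`restrS_starZ`). This yields the left ideal, the
representation and its explicit form at once.

For the inner product, integration by parts in `q` under `∫ i*` replaces the Poisson operator by `Δ
⊗ 1 - 1 ⊗ Δ`, so `∫ i*(f * g) = ∫ i*(𝒮⁻¹f · 𝒮g)`. Conjugation turns `𝒮` into `𝒮⁻¹`, so `ω₀(f̄ * g)`
is the `L²` product of `i*𝒮f` and `i*𝒮g` (`gnsPairing_eq_l2`). The `L²` product is definite, as the
lowest coefficient shows, so the Gel'fand ideal is the kernel of `i*𝒮`. That map is onto because
`i*𝒮π*φ = φ`. -/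

theorem Laurent.ext {f g : Laurent V} (h : ∀ k, coef f k = coef g k) : f = g :=
  toHahn.injective (HahnSeries.ext (funext h))

@[simp] theorem coef_zero (k : ℤ) : coef (0 : Laurent V) k = 0 := rfl
@[simp] theorem coef_add (f g : Laurent V) (k : ℤ) : coef (f + g) k = coef f k + coef g k := rfl

/-- All coefficients in degrees below `m` vanish. -/
def VanishesBelow (m : ℤ) (f : Laurent V) : Prop := ∀ k < m, coef f k = 0

/-- The series `∑ j, c j λ ^ (a + j)`. -/
def shiftedSeries (a : ℤ) (c : ℕ → V) : Laurent V :=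
  ofCoef (fun k => if a ≤ k then c (k - a).toNat else 0)
    ⟨a, fun k hk => if_neg (by omega)⟩

/-- The monomial `v λ ^ a`. -/
def mono (a : ℤ) (v : V) : Laurent V :=
  ofCoef (fun k => if k = a then v else 0) ⟨a, fun k hk => if_neg (by omega)⟩

theorem coef_shiftedSeries (a : ℤ) (c : ℕ → V) (k : ℤ) :
    coef (shiftedSeries a c) k = if a ≤ k then c (k - a).toNat else 0 := rfl

theorem coef_mono (a : ℤ) (v : V) (k : ℤ) : coef (mono a v) k = if k = a then v else 0 := rfl

theorem coef_sum {ι : Type*} (s : Finset ι) (f : ι → Laurent V) (k : ℤ) :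
    coef (∑ i ∈ s, f i) k = ∑ i ∈ s, coef (f i) k :=
  map_sum (⟨⟨fun f : Laurent V => coef f k, rfl⟩, fun _ _ => rfl⟩ : Laurent V →+ V) f s

/-- Additive maps that raise the degree by at least `s` are determined by their values on
monomials. -/
theorem addHom_ext_mono {T T' : Laurent V →+ Laurent W} (s : ℤ)
    (hT : ∀ m f, VanishesBelow m f → VanishesBelow (m + s) (T f))
    (hT' : ∀ m f, VanishesBelow m f → VanishesBelow (m + s) (T' f))
    (h : ∀ a v, T (mono a v) = T' (mono a v)) (f : Laurent V) : T f = T' f := by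
  obtain ⟨m, hm⟩ := exists_coef_eq_zero f
  refine Laurent.ext fun k => ?_
  -- Terms of `f` in degrees above `k - s` cannot reach degree `k`, so for this coefficient `f` may
  -- be truncated to finitely many monomials.
  set p : Laurent V := ∑ a ∈ Finset.Ico m (k - s + 1), mono a (coef f a) with hp
  have hv : VanishesBelow (k - s + 1) (f - p) := by
    intro l hl
    have h1 : coef (f - p) l = coef f l - coef p l := rfl
    rw [h1, hp, coef_sum]
    simp only [coef_mono, Finset.sum_ite_eq, Finset.mem_Ico]
    split_ifs with hc
    · exact sub_self _
    · rw [hm l (by omega), sub_zero]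
  have hTp : T p = T' p := by
    rw [hp, map_sum, map_sum]
    exact Finset.sum_congr rfl fun a _ => h _ _
  have e : f = p + (f - p) := by abel
  rw [e, map_add, map_add, coef_add, coef_add, hTp, hT _ _ hv k (by omega),
    hT' _ _ hv k (by omega)]

theorem coef_bilinSeries (B : ℕ → V →ₗ[ℂ] W →ₗ[ℂ] U) (f : Laurent V) (g : Laurent W) (k : ℤ) :
    coef (bilinSeries B f g) k = ∑ᶠ x : ℕ × ℤ, B x.1 (coef f x.2) (coef g (k - x.1 - x.2)) := rfl

theorem coef_opSeries (D : ℕ → V →ₗ[ℂ] W) (f : Laurent V) (k : ℤ) :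
    coef (opSeries D f) k = ∑ᶠ r : ℕ, D r (coef f (k - r)) := rfl

theorem bilinSeries_congr {B B' : ℕ → V →ₗ[ℂ] W →ₗ[ℂ] U} {f : Laurent V} {g : Laurent W}
    (h : ∀ r a b, B r (coef f a) (coef g b) = B' r (coef f a) (coef g b)) :
    bilinSeries B f g = bilinSeries B' f g :=
  Laurent.ext fun _ => finsum_congr fun _ => h _ _ _

/-- The three degrees add up to `k` and each is bounded below (by `0`, `m` and `m'`), so each is
also bounded above. -/
theorem bilinSeries_support_finite (B : ℕ → V →ₗ[ℂ] W →ₗ[ℂ] U) (f : Laurent V) (g : Laurent W)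
    (k : ℤ) :
    (Function.support fun x : ℕ × ℤ => B x.1 (coef f x.2) (coef g (k - x.1 - x.2))).Finite := by
  obtain ⟨m, hm⟩ := exists_coef_eq_zero f
  obtain ⟨m', hm'⟩ := exists_coef_eq_zero g
  refine ((Finset.range ((k - m - m').toNat + 1) ×ˢ Finset.Icc m (k - m')).finite_toSet).subset ?_
  rintro ⟨r, a⟩ hx
  have h1 : m ≤ a := by
    by_contra hlt
    exact hx (by simp [hm a (by omega)])
  have h2 : m' ≤ k - r - a := by
    by_contra hlt
    exact hx (by simp [hm' (k - r - a) (by omega)])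
  simp only [Finset.coe_product, Set.mem_prod, Finset.mem_coe, Finset.mem_range, Finset.mem_Icc]
  omega

theorem bilinSeries_add_left (B : ℕ → V →ₗ[ℂ] W →ₗ[ℂ] U) (f f' : Laurent V) (g : Laurent W) :
    bilinSeries B (f + f') g = bilinSeries B f g + bilinSeries B f' g := by
  refine Laurent.ext fun k => ?_
  rw [coef_add, coef_bilinSeries, coef_bilinSeries, coef_bilinSeries,
    ← finsum_add_distrib (bilinSeries_support_finite B f g k)
      (bilinSeries_support_finite B f' g k)]
  simp only [coef_add, map_add, LinearMap.add_apply]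

theorem bilinSeries_flip (B : ℕ → V →ₗ[ℂ] W →ₗ[ℂ] U) (f : Laurent V) (g : Laurent W) :
    bilinSeries (fun r => (B r).flip) g f = bilinSeries B f g := by
  refine Laurent.ext fun k => ?_
  rw [coef_bilinSeries, coef_bilinSeries]
  -- For fixed `r`, exchanging the degrees of the two arguments is the involution `a ↦ k - r - a`.
  let e : ℕ × ℤ ≃ ℕ × ℤ :=
    { toFun := fun x => (x.1, k - x.1 - x.2)
      invFun := fun x => (x.1, k - x.1 - x.2)
      left_inv := fun x => by simp
      right_inv := fun x => by simp }
  refine finsum_eq_of_bijective e e.bijective fun x => ?_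
  simp [e, LinearMap.flip_apply]

theorem bilinSeries_add_right (B : ℕ → V →ₗ[ℂ] W →ₗ[ℂ] U) (f : Laurent V) (g g' : Laurent W) :
    bilinSeries B f (g + g') = bilinSeries B f g + bilinSeries B f g' := by
  simp only [← bilinSeries_flip B, bilinSeries_add_left]

theorem bilinSeries_vanishesBelow (B : ℕ → V →ₗ[ℂ] W →ₗ[ℂ] U) {m m' : ℤ} {f : Laurent V}
    {g : Laurent W} (hf : VanishesBelow m f) (hg : VanishesBelow m' g) :
    VanishesBelow (m + m') (bilinSeries B f g) := by
  intro k hk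
  refine finsum_eq_zero_of_forall_eq_zero fun x => ?_
  by_cases h : x.2 < m
  · rw [hf _ h, map_zero, LinearMap.zero_apply]
  · rw [hg _ (by omega), map_zero]

/-- `bilinSeries B` as a biadditive map. -/
def bilinHom (B : ℕ → V →ₗ[ℂ] W →ₗ[ℂ] U) : Laurent V →+ Laurent W →+ Laurent U :=
  AddMonoidHom.mk' (fun f => AddMonoidHom.mk' (bilinSeries B f) (bilinSeries_add_right B f))
    fun f f' => AddMonoidHom.ext fun g => bilinSeries_add_left B f f' g

theorem bilinSeries_shiftedSeries_mono (B : ℕ → V →ₗ[ℂ] W →ₗ[ℂ] U) (a b : ℤ) (c : ℕ → V) (w : W) :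
    bilinSeries B (shiftedSeries a c) (mono b w) =
      shiftedSeries (a + b) fun n => ∑ x ∈ antidiagonal n, B x.1 (c x.2) w := by
  refine Laurent.ext fun k => ?_
  rw [coef_bilinSeries, coef_shiftedSeries]
  split_ifs with hk
  · let e : ℕ × ℕ → ℕ × ℤ := fun x => (x.1, a + x.2)
    have he : Function.Injective e := fun x y h => by
      simp only [e, Prod.mk.injEq] at h
      ext <;> omega
    rw [finsum_eq_sum_of_support_subset (s := (antidiagonal (k - (a + b)).toNat).map
      ⟨e, he⟩), Finset.sum_map]
    · refine Finset.sum_congr rfl fun x hx => ?_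
      rw [Finset.HasAntidiagonal.mem_antidiagonal] at hx
      simp only [e, Function.Embedding.coeFn_mk, coef_shiftedSeries, coef_mono]
      rw [if_pos (by omega), if_pos (by omega)]
      simp
    · rintro ⟨r, l⟩ hx
      rw [Function.mem_support] at hx
      simp only [coef_shiftedSeries, coef_mono] at hx
      have h1 : a ≤ l := by
        by_contra hlt
        exact hx (by simp [hlt])
      have h2 : k - r - l = b := by
        by_contra hlt
        exact hx (by simp [hlt])
      simp only [Finset.coe_map, Function.Embedding.coeFn_mk, Set.mem_image, Finset.mem_coe,
        Finset.HasAntidiagonal.mem_antidiagonal]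
      refine ⟨(r, (l - a).toNat), by simp only; omega, ?_⟩
      simp only [e, Prod.mk.injEq, true_and]
      omega
  · refine finsum_eq_zero_of_forall_eq_zero fun x => ?_
    rw [coef_shiftedSeries, coef_mono]
    split_ifs with h1 h2
    · omega
    · simp
    · simp
    · simp

theorem bilinSeries_mono_shiftedSeries (B : ℕ → V →ₗ[ℂ] W →ₗ[ℂ] U) (a b : ℤ) (v : V) (c : ℕ → W) :
    bilinSeries B (mono a v) (shiftedSeries b c) =
      shiftedSeries (a + b) fun n => ∑ x ∈ antidiagonal n, B x.1 v (c x.2) := by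
  rw [← bilinSeries_flip, bilinSeries_shiftedSeries_mono, add_comm]
  rfl

theorem mono_eq_shiftedSeries (a : ℤ) (v : V) : mono a v = shiftedSeries a (Pi.single 0 v) := by
  refine Laurent.ext fun k => ?_
  rw [coef_mono, coef_shiftedSeries]
  by_cases h : k = a
  · simp [h]
  · by_cases h' : a ≤ k
    · rw [if_neg h, if_pos h', Pi.single_eq_of_ne (by omega)]
    · rw [if_neg h, if_neg h']

theorem sum_antidiagonal_eq_left {M : Type*} [AddCommMonoid M] (F : ℕ × ℕ → M) (n : ℕ)
    (h : ∀ i j, j ≠ 0 → F (i, j) = 0) : ∑ x ∈ antidiagonal n, F x = F (n, 0) := by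
  refine Finset.sum_eq_single (n, 0) (fun x hx hne => ?_) (by simp)
  rw [Finset.HasAntidiagonal.mem_antidiagonal] at hx
  refine h x.1 x.2 fun h0 => hne ?_
  ext <;> simp <;> omega

theorem sum_antidiagonal_eq_right {M : Type*} [AddCommMonoid M] (F : ℕ × ℕ → M) (n : ℕ)
    (h : ∀ i j, i ≠ 0 → F (i, j) = 0) : ∑ x ∈ antidiagonal n, F x = F (0, n) := by
  refine Finset.sum_eq_single (0, n) (fun x hx hne => ?_) (by simp)
  rw [Finset.HasAntidiagonal.mem_antidiagonal] at hx
  refine h x.1 x.2 fun h0 => hne ?_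
  ext <;> simp <;> omega

theorem bilinSeries_mono_mono (B : ℕ → V →ₗ[ℂ] W →ₗ[ℂ] U) (a b : ℤ) (v : V) (w : W) :
    bilinSeries B (mono a v) (mono b w) = shiftedSeries (a + b) fun n => B n v w := by
  rw [mono_eq_shiftedSeries a, bilinSeries_shiftedSeries_mono]
  congr 1
  funext n
  rw [sum_antidiagonal_eq_left _ n fun i j hj => by simp [Pi.single_eq_of_ne hj]]
  simp

variable {X Y : Type*} [AddCommGroup X] [Module ℂ X] [AddCommGroup Y] [Module ℂ Y]

/-- Mixed associativity of formal bilinear operations can be checked on coefficients. -/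
theorem bilinSeries_assoc {B : ℕ → X →ₗ[ℂ] W →ₗ[ℂ] Z} {C : ℕ → U →ₗ[ℂ] V →ₗ[ℂ] X}
    {B' : ℕ → U →ₗ[ℂ] Y →ₗ[ℂ] Z} {C' : ℕ → V →ₗ[ℂ] W →ₗ[ℂ] Y}
    (h : ∀ n u v w, ∑ x ∈ antidiagonal n, B x.1 (C x.2 u v) w =
      ∑ x ∈ antidiagonal n, B' x.1 u (C' x.2 v w))
    (f : Laurent U) (g : Laurent V) (k : Laurent W) :
    bilinSeries B (bilinSeries C f g) k = bilinSeries B' f (bilinSeries C' g k) := by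
  obtain ⟨mf, hf⟩ := exists_coef_eq_zero f
  obtain ⟨mg, hg⟩ := exists_coef_eq_zero g
  refine addHom_ext_mono (T := bilinHom B (bilinSeries C f g))
    (T' := (bilinHom B' f).comp (bilinHom C' g)) (mf + mg) (fun m k hk => ?_) (fun m k hk => ?_)
    (fun c w => ?_) k
  · rw [add_comm m]
    exact bilinSeries_vanishesBelow _ (bilinSeries_vanishesBelow _ hf hg) hk
  · rw [add_comm m, add_assoc]
    exact bilinSeries_vanishesBelow _ hf (bilinSeries_vanishesBelow _ hg hk)
  -- The third argument is now a monomial; the second and then the first are reduced in the same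
  -- way. On three monomials both sides are power series whose coefficients are the convolutions in
  -- `h`.
  refine addHom_ext_mono (T := ((bilinHom B).flip (mono c w)).comp (bilinHom C f))
    (T' := (bilinHom B' f).comp ((bilinHom C').flip (mono c w))) (mf + c) (fun m g hg => ?_)
    (fun m g hg => ?_) (fun b v => ?_) g
  · rw [show m + (mf + c) = mf + m + c by ring]
    exact bilinSeries_vanishesBelow _ (bilinSeries_vanishesBelow _ hf hg)
      (fun l hl => if_neg (by omega))
  · rw [show m + (mf + c) = mf + (m + c) by ring]
    exact bilinSeries_vanishesBelow _ hf (bilinSeries_vanishesBelow _ hg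
      (fun l hl => if_neg (by omega)))
  refine addHom_ext_mono
    (T := ((bilinHom B).flip (mono c w)).comp ((bilinHom C).flip (mono b v)))
    (T' := (bilinHom B').flip (bilinSeries C' (mono b v) (mono c w))) (b + c) (fun m f hf => ?_)
    (fun m f hf => ?_) (fun a u => ?_) f
  · rw [← add_assoc]
    exact bilinSeries_vanishesBelow _ (bilinSeries_vanishesBelow _ hf
      (fun l hl => if_neg (by omega))) (fun l hl => if_neg (by omega))
  · exact bilinSeries_vanishesBelow _ hf (bilinSeries_vanishesBelow _
      (fun l hl => if_neg (by omega)) (fun l hl => if_neg (by omega)))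
  change bilinSeries B (bilinSeries C (mono a u) (mono b v)) (mono c w) =
    bilinSeries B' (mono a u) (bilinSeries C' (mono b v) (mono c w))
  rw [bilinSeries_mono_mono, bilinSeries_mono_mono, bilinSeries_shiftedSeries_mono,
    bilinSeries_mono_shiftedSeries, add_assoc]
  congr 1
  funext n
  exact h n u v w

/-! ### Scalars, products and operators as bilinear series -/

/-- An element of `ℂ((λ))` as a Laurent series with coefficients in the vector space `ℂ`. -/
def ofScalar (c : CLaurent) : Laurent ℂ := toHahn.symm (CLaurent.ofSeries.symm c)

/-- The bilinear series concentrated in degree zero. -/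
def constBilin (b : V →ₗ[ℂ] W →ₗ[ℂ] U) : ℕ → V →ₗ[ℂ] W →ₗ[ℂ] U := Pi.single 0 b

/-- The index set `s` is left free so that the formula fits both the scalar action and the product
of Hahn series, which sum over different antidiagonals. -/
theorem coef_bilinSeries_constBilin (b : V →ₗ[ℂ] W →ₗ[ℂ] U) (f : Laurent V) (g : Laurent W)
    (k : ℤ) (s : Finset (ℤ × ℤ)) (hs : ∀ x ∈ s, x.1 + x.2 = k)
    (hs' : ∀ i j, i + j = k → coef f i ≠ 0 → coef g j ≠ 0 → (i, j) ∈ s) :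
    coef (bilinSeries (constBilin b) f g) k = ∑ x ∈ s, b (coef f x.1) (coef g x.2) := by
  let e : ℤ × ℤ → ℕ × ℤ := fun x => (0, x.1)
  have he : Set.InjOn e s := fun x hx y hy h => by
    simp only [e, Prod.mk.injEq] at h
    have := hs x hx
    have := hs y hy
    ext <;> omega
  rw [coef_bilinSeries, finsum_eq_sum_of_support_subset (s := s.image e), Finset.sum_image he]
  · refine Finset.sum_congr rfl fun x hx => ?_
    have : k - 0 - x.1 = x.2 := by have := hs x hx; omega
    simp [e, constBilin, ← hs x hx]
  · rintro ⟨r, l⟩ hx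
    rw [Function.mem_support] at hx
    have hr : r = 0 := by
      by_contra hr
      exact hx (by simp [constBilin, Pi.single_eq_of_ne hr])
    subst hr
    rw [Finset.coe_image]
    refine ⟨(l, k - l), hs' _ _ (by omega) (fun h0 => hx (by simp [h0])) (fun h0 => hx ?_), rfl⟩
    simp [h0]

theorem smul_eq_bilinSeries (c : CLaurent) (f : Laurent V) :
    c • f = bilinSeries (constBilin (LinearMap.lsmul ℂ V)) (ofScalar c) f := by
  refine Laurent.ext fun k => ?_
  have h : coef (c • f) k = _ := HahnModule.coeff_smul (CLaurent.ofSeries.symm c)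
    (show HahnModule ℤ ℂ V from f) k
  rw [h]
  symm
  refine coef_bilinSeries_constBilin _ _ _ k _ (fun x hx => ?_) (fun i j hij hi hj => ?_)
  · exact ((Finset.mem_vaddAntidiagonal _ _).mp hx).2.2
  · exact (Finset.mem_vaddAntidiagonal _ _).mpr ⟨hi, hj, hij⟩

theorem mulL_eq_bilinSeries {E : Type*} [NormedAddCommGroup E] [NormedSpace ℝ E]
    (f g : Laurent (Smooth E)) :
    mulL f g = bilinSeries (constBilin (LinearMap.mul ℂ (Smooth E))) f g := by
  refine Laurent.ext fun k => ?_
  rw [coef_mulL]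
  symm
  refine coef_bilinSeries_constBilin _ _ _ k _ (fun x hx => ?_) (fun i j hij hi hj => ?_)
  · exact (Finset.mem_antidiagonal.mp hx).2.2
  · exact Finset.mem_antidiagonal.mpr ⟨hi, hj, hij⟩

/-- An operator series as a bilinear series with scalars as its first argument. -/
def opBilin (D : ℕ → V →ₗ[ℂ] W) (r : ℕ) : ℂ →ₗ[ℂ] V →ₗ[ℂ] W :=
  (LinearMap.lsmul ℂ (V →ₗ[ℂ] W)).flip (D r)

@[simp] theorem opBilin_apply (D : ℕ → V →ₗ[ℂ] W) (r : ℕ) (c : ℂ) (v : V) :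
    opBilin D r c v = c • D r v := rfl

theorem opSeries_eq_bilinSeries (D : ℕ → V →ₗ[ℂ] W) (f : Laurent V) :
    opSeries D f = bilinSeries (opBilin D) (mono 0 1) f := by
  refine Laurent.ext fun k => ?_
  rw [coef_opSeries, coef_bilinSeries]
  have : ∀ x : ℕ × ℤ, x.2 ≠ 0 →
      opBilin D x.1 (coef (mono 0 (1 : ℂ)) x.2) (coef f (k - x.1 - x.2)) = 0 := by
    intro x hx
    rw [coef_mono, if_neg hx, map_zero, LinearMap.zero_apply]
  -- Only the pairs `(r, 0)` contribute, so the sum may be restricted to the range of `r ↦ (r, 0)`.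
  rw [← finsum_mem_univ (f := fun x : ℕ × ℤ => _), finsum_mem_inter_support_eq' _ Set.univ
    (Set.range fun r : ℕ => (r, (0 : ℤ))), finsum_mem_range (fun a b h => by simpa using h)]
  · refine finsum_congr fun r => ?_
    simp [coef_mono]
  · rintro ⟨r, a⟩ hx
    have ha : a = 0 := by
      by_contra ha
      exact hx (this (r, a) ha)
    simp [ha]

theorem mono_smul (f : Laurent V) :
    bilinSeries (constBilin (LinearMap.lsmul ℂ V)) (mono 0 1) f = f := by
  have h : ofScalar 1 = mono 0 (1 : ℂ) := by
    refine Laurent.ext fun k => ?_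
    rw [coef_mono]
    refine HahnSeries.coeff_one.trans ?_
    split_ifs <;> rfl
  rw [← h, ← smul_eq_bilinSeries, one_smul]

/-- The hypothesis is required only at the actual coefficients of the series, so identities that
need a support condition, such as integration by parts, can be fed in. -/
theorem mapCoef_bilinSeries {X Y : Type*} [AddCommGroup X] [Module ℂ X] [AddCommGroup Y]
    [Module ℂ Y] (L : U →ₗ[ℂ] Z) {B : ℕ → V →ₗ[ℂ] W →ₗ[ℂ] U} {B' : ℕ → X →ₗ[ℂ] Y →ₗ[ℂ] Z}
    {f : Laurent V} {g : Laurent W} {f' : Laurent X} {g' : Laurent Y}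
    (h : ∀ r a b, L (B r (coef f a) (coef g b)) = B' r (coef f' a) (coef g' b)) :
    mapCoef L.toAddMonoidHom.toZeroHom (bilinSeries B f g) = bilinSeries B' f' g' := by
  refine Laurent.ext fun k => ?_
  rw [coef_mapCoef, coef_bilinSeries, coef_bilinSeries]
  exact (L.toAddMonoidHom.map_finsum (bilinSeries_support_finite B f g k)).trans
    (finsum_congr fun x => h _ _ _)

/-- With an operator series viewed as a bilinear one applied to the scalar `1`, this composition
rule is an instance of mixed associativity. -/
theorem bilinSeries_opSeries_left {B : ℕ → V →ₗ[ℂ] W →ₗ[ℂ] U} {D : ℕ → Z →ₗ[ℂ] V}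
    {B' : ℕ → Z →ₗ[ℂ] W →ₗ[ℂ] U}
    (h : ∀ n z w, ∑ x ∈ antidiagonal n, B x.1 (D x.2 z) w = B' n z w)
    (f : Laurent Z) (g : Laurent W) :
    bilinSeries B (opSeries D f) g = bilinSeries B' f g := by
  rw [opSeries_eq_bilinSeries, ← mono_smul (bilinSeries B' f g)]
  refine bilinSeries_assoc (fun n c z w => ?_) _ _ _
  refine Eq.trans ?_ (sum_antidiagonal_eq_right _ n fun i j hi => by
    simp [constBilin, Pi.single_eq_of_ne hi]).symm
  simp [constBilin, ← h]

theorem bilinSeries_opSeries_right {B : ℕ → V →ₗ[ℂ] W →ₗ[ℂ] U} {D : ℕ → Z →ₗ[ℂ] W}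
    {B' : ℕ → V →ₗ[ℂ] Z →ₗ[ℂ] U}
    (h : ∀ n v z, ∑ x ∈ antidiagonal n, B x.1 v (D x.2 z) = B' n v z)
    (f : Laurent V) (g : Laurent Z) :
    bilinSeries B f (opSeries D g) = bilinSeries B' f g := by
  rw [← bilinSeries_flip, ← bilinSeries_flip B']
  exact bilinSeries_opSeries_left (fun n z v => h n v z) g f

theorem opSeries_bilinSeries {D : ℕ → U →ₗ[ℂ] Z} {B : ℕ → V →ₗ[ℂ] W →ₗ[ℂ] U}
    {B' : ℕ → V →ₗ[ℂ] W →ₗ[ℂ] Z}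
    (h : ∀ n v w, ∑ x ∈ antidiagonal n, D x.1 (B x.2 v w) = B' n v w)
    (f : Laurent V) (g : Laurent W) :
    opSeries D (bilinSeries B f g) = bilinSeries B' f g := by
  rw [opSeries_eq_bilinSeries]
  conv_rhs => rw [← mono_smul f]
  symm
  refine bilinSeries_assoc (fun n c v w => ?_) _ _ _
  rw [sum_antidiagonal_eq_left _ n fun i j hi => by simp [constBilin, Pi.single_eq_of_ne hi]]
  simp [constBilin, ← h, Finset.smul_sum]

theorem bilinSeries_smul_left (B : ℕ → V →ₗ[ℂ] W →ₗ[ℂ] U) (c : CLaurent) (f : Laurent V)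
    (g : Laurent W) : bilinSeries B (c • f) g = c • bilinSeries B f g := by
  rw [smul_eq_bilinSeries, smul_eq_bilinSeries]
  refine bilinSeries_assoc (fun n z v w => ?_) _ _ _
  rw [sum_antidiagonal_eq_left _ n fun i j hi => by simp [constBilin, Pi.single_eq_of_ne hi],
    sum_antidiagonal_eq_right _ n fun i j hi => by simp [constBilin, Pi.single_eq_of_ne hi]]
  simp [constBilin]

theorem bilinSeries_smul_right (B : ℕ → V →ₗ[ℂ] W →ₗ[ℂ] U) (c : CLaurent) (f : Laurent V)
    (g : Laurent W) : bilinSeries B f (c • g) = c • bilinSeries B f g := by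
  rw [← bilinSeries_flip, bilinSeries_smul_left, bilinSeries_flip]

theorem opSeries_add (D : ℕ → V →ₗ[ℂ] W) (f g : Laurent V) :
    opSeries D (f + g) = opSeries D f + opSeries D g := by
  simp only [opSeries_eq_bilinSeries, bilinSeries_add_right]

theorem opSeries_smul (D : ℕ → V →ₗ[ℂ] W) (c : CLaurent) (f : Laurent V) :
    opSeries D (c • f) = c • opSeries D f := by
  simp only [opSeries_eq_bilinSeries, bilinSeries_smul_right]

end LaurentSeries

/-! ### Formal exponentials of operators -/

section ExpCoef

variable {M N : Type*} [AddCommGroup M] [Module ℂ M] [AddCommGroup N] [Module ℂ N]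

/-- The coefficient `X ^ r / r!` of the formal exponential `exp (λ X)`. -/
def expCoef (X : Module.End ℂ M) (r : ℕ) : Module.End ℂ M := (1 / (r.factorial : ℂ)) • X ^ r

/-- The binomial theorem, in the form `exp(λX) exp(λY) = exp(λ(X + Y))` for commuting operators. -/
theorem sum_expCoef_mul_expCoef {X Y : Module.End ℂ M} (h : Commute X Y) (r : ℕ) :
    ∑ x ∈ antidiagonal r, expCoef X x.1 * expCoef Y x.2 = expCoef (X + Y) r := by
  rw [expCoef, h.add_pow', Finset.smul_sum]
  refine Finset.sum_congr rfl fun x hx => ?_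
  rw [Finset.HasAntidiagonal.mem_antidiagonal] at hx
  subst hx
  rw [expCoef, expCoef, smul_mul_smul_comm, ← Nat.cast_smul_eq_nsmul ℂ, smul_smul]
  congr 1
  have h0 := Nat.choose_mul_factorial_mul_factorial (Nat.le_add_right x.1 x.2)
  rw [Nat.add_sub_cancel_left] at h0
  have := Nat.cast_ne_zero (R := ℂ).mpr (x.1 + x.2).factorial_ne_zero
  have := Nat.cast_ne_zero (R := ℂ).mpr x.1.factorial_ne_zero
  have := Nat.cast_ne_zero (R := ℂ).mpr x.2.factorial_ne_zero
  field_simp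
  rw [← h0]
  push_cast
  ring

theorem expCoef_comp_of_comp_eq {X : Module.End ℂ N} {Y : Module.End ℂ M} {L : M →ₗ[ℂ] N}
    (h : X ∘ₗ L = L ∘ₗ Y) (r : ℕ) : expCoef X r ∘ₗ L = L ∘ₗ expCoef Y r := by
  have hp : ∀ r, (X ^ r) ∘ₗ L = L ∘ₗ (Y ^ r) := by
    intro r
    induction r with
    | zero => rfl
    | succ r ih =>
      rw [pow_succ, pow_succ, Module.End.mul_eq_comp, Module.End.mul_eq_comp, LinearMap.comp_assoc,
        h, ← LinearMap.comp_assoc, ih, LinearMap.comp_assoc]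
  rw [expCoef, expCoef, LinearMap.smul_comp, hp, LinearMap.comp_smul]

theorem expCoef_apply_of_comp_eq {X : Module.End ℂ N} {Y : Module.End ℂ M} {L : M →ₗ[ℂ] N}
    (h : X ∘ₗ L = L ∘ₗ Y) (r : ℕ) (v : M) : expCoef X r (L v) = L (expCoef Y r v) :=
  LinearMap.congr_fun (expCoef_comp_of_comp_eq h r) v

theorem expCoef_smul (c : ℂ) (X : Module.End ℂ M) (r : ℕ) :
    expCoef (c • X) r = ((1 / (r.factorial : ℂ)) * c ^ r) • X ^ r := by
  rw [expCoef, smul_pow, smul_smul]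

end ExpCoef

/-! ### Products of the form `μ ∘ exp(λX)` -/

section TensorCoef

variable {A : Type*} [CommRing A] [Algebra ℂ A]

/-- The bilinear operations `μ (X ^ r / r!) (f ⊗ g)`, with `μ` the multiplication of `A`. -/
def tensorCoef (X : Module.End ℂ (A ⊗[ℂ] A)) (r : ℕ) : A →ₗ[ℂ] A →ₗ[ℂ] A :=
  (TensorProduct.mk ℂ A A).compr₂ (LinearMap.mul' ℂ A ∘ₗ expCoef X r)

theorem tensorCoef_apply (X : Module.End ℂ (A ⊗[ℂ] A)) (r : ℕ) (u v : A) :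
    tensorCoef X r u v = LinearMap.mul' ℂ A (expCoef X r (u ⊗ₜ v)) := rfl

theorem commute_map {a c b d : Module.End ℂ A} (h : Commute a c) (h' : Commute b d) :
    Commute (TensorProduct.map a b) (TensorProduct.map c d) := by
  rw [Commute, SemiconjBy, ← TensorProduct.map_mul, ← TensorProduct.map_mul, h.eq, h'.eq]

theorem opSeries_expCoef_tensorCoef {D : Module.End ℂ A} {D' X : Module.End ℂ (A ⊗[ℂ] A)}
    (h : D ∘ₗ LinearMap.mul' ℂ A = LinearMap.mul' ℂ A ∘ₗ D') (hc : Commute D' X)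
    (f g : Laurent A) :
    opSeries (expCoef D) (bilinSeries (tensorCoef X) f g) =
      bilinSeries (tensorCoef (D' + X)) f g := by
  refine opSeries_bilinSeries (fun r u v => ?_) f g
  rw [tensorCoef_apply, ← sum_expCoef_mul_expCoef hc, LinearMap.sum_apply, map_sum]
  refine Finset.sum_congr rfl fun x _ => ?_
  rw [tensorCoef_apply, expCoef_apply_of_comp_eq h, Module.End.mul_apply]

theorem bilinSeries_tensorCoef_expCoef_left {D : Module.End ℂ A} {X : Module.End ℂ (A ⊗[ℂ] A)}
    (hc : Commute X (TensorProduct.map D 1)) (f g : Laurent A) :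
    bilinSeries (tensorCoef X) (opSeries (expCoef D) f) g =
      bilinSeries (tensorCoef (X + TensorProduct.map D 1)) f g := by
  refine bilinSeries_opSeries_left (fun r u v => ?_) f g
  rw [tensorCoef_apply, ← sum_expCoef_mul_expCoef hc, LinearMap.sum_apply, map_sum]
  refine Finset.sum_congr rfl fun x _ => ?_
  have h : TensorProduct.map D 1 ∘ₗ (TensorProduct.mk ℂ A A).flip v =
      (TensorProduct.mk ℂ A A).flip v ∘ₗ D := LinearMap.ext fun u => rfl
  rw [tensorCoef_apply, Module.End.mul_apply]
  exact congrArg _ (congrArg _ (expCoef_apply_of_comp_eq h x.2 u).symm)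

theorem bilinSeries_tensorCoef_expCoef_right {D : Module.End ℂ A} {X : Module.End ℂ (A ⊗[ℂ] A)}
    (hc : Commute X (TensorProduct.map 1 D)) (f g : Laurent A) :
    bilinSeries (tensorCoef X) f (opSeries (expCoef D) g) =
      bilinSeries (tensorCoef (X + TensorProduct.map 1 D)) f g := by
  refine bilinSeries_opSeries_right (fun r u v => ?_) f g
  rw [tensorCoef_apply, ← sum_expCoef_mul_expCoef hc, LinearMap.sum_apply, map_sum]
  refine Finset.sum_congr rfl fun x _ => ?_
  have h : TensorProduct.map 1 D ∘ₗ TensorProduct.mk ℂ A A u =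
      TensorProduct.mk ℂ A A u ∘ₗ D := LinearMap.ext fun v => rfl
  rw [tensorCoef_apply, Module.End.mul_apply]
  exact congrArg _ (congrArg _ (expCoef_apply_of_comp_eq h x.2 v).symm)

/-- The product `μ exp (λ X)` is associative, where `X = c ∑ k, d k ⊗ e k` for commuting
derivations `d k`, `e k`. -/
theorem bilinSeries_tensorCoef_assoc {ι : Type*} [Fintype ι] {d e : ι → Module.End ℂ A}
    (hd : ∀ k u v, d k (u * v) = d k u * v + u * d k v)
    (he : ∀ k u v, e k (u * v) = e k u * v + u * e k v)
    (hdd : ∀ k l, Commute (d k) (d l)) (hde : ∀ k l, Commute (d k) (e l))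
    (hee : ∀ k l, Commute (e k) (e l)) (c : ℂ) (f g h : Laurent A) :
    bilinSeries (tensorCoef (c • ∑ k, TensorProduct.map (d k) (e k)))
        (bilinSeries (tensorCoef (c • ∑ k, TensorProduct.map (d k) (e k))) f g) h =
      bilinSeries (tensorCoef (c • ∑ k, TensorProduct.map (d k) (e k))) f
        (bilinSeries (tensorCoef (c • ∑ k, TensorProduct.map (d k) (e k))) g h) := by
  set X : Module.End ℂ (A ⊗[ℂ] A) := c • ∑ k, TensorProduct.map (d k) (e k) with hX
  let μ := LinearMap.mul' ℂ A
  let Y : Module.End ℂ ((A ⊗[ℂ] A) ⊗[ℂ] A) := c • ∑ k, TensorProduct.map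
    (TensorProduct.map (d k) 1 + TensorProduct.map 1 (d k)) (e k)
  let Y' : Module.End ℂ (A ⊗[ℂ] (A ⊗[ℂ] A)) := c • ∑ k, TensorProduct.map (d k)
    (TensorProduct.map (e k) 1 + TensorProduct.map 1 (e k))
  let X₁ : Module.End ℂ ((A ⊗[ℂ] A) ⊗[ℂ] A) := TensorProduct.map X 1
  let X₂ : Module.End ℂ (A ⊗[ℂ] (A ⊗[ℂ] A)) := TensorProduct.map 1 X
  let α := (TensorProduct.assoc ℂ A A A).toLinearMap
  -- By the Leibniz rule for `d k`, `Y` is the action of `X` on `(u v) ⊗ w` before the product `u v`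
  -- is formed; `Y'` plays the same role for `u ⊗ (v w)`.
  have hY : X ∘ₗ TensorProduct.map μ LinearMap.id = TensorProduct.map μ LinearMap.id ∘ₗ Y := by
    refine TensorProduct.ext_threefold fun u v w => ?_
    simp [X, Y, μ, hd, TensorProduct.add_tmul, map_sum]
  have hY' : X ∘ₗ TensorProduct.map LinearMap.id μ = TensorProduct.map LinearMap.id μ ∘ₗ Y' := by
    refine TensorProduct.ext (LinearMap.ext fun u => TensorProduct.ext' fun v w => ?_)
    simp [X, Y', μ, he, TensorProduct.tmul_add, map_sum]
  -- The heart of associativity: with subscripts for the tensor slots, both total exponents are `c ∑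
  -- (d₁ e₂ + d₁ e₃ + d₂ e₃)`.
  have hα : (X₂ + Y') ∘ₗ α = α ∘ₗ (X₁ + Y) := by
    refine TensorProduct.ext_threefold fun u v w => ?_
    simp only [X₁, X₂, Y, Y', α, X, LinearMap.comp_apply, LinearMap.add_apply,
      LinearEquiv.coe_coe, TensorProduct.assoc_tmul, TensorProduct.map_tmul,
      LinearMap.smul_apply, LinearMap.sum_apply, Module.End.one_apply, TensorProduct.tmul_smul,
      ← TensorProduct.smul_tmul', TensorProduct.tmul_sum, TensorProduct.sum_tmul, map_add, map_smul,
      map_sum, TensorProduct.add_tmul, TensorProduct.tmul_add, Finset.sum_add_distrib, smul_add]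
    abel
  have hμ : ∀ t, μ (TensorProduct.map LinearMap.id μ (α t)) =
      μ (TensorProduct.map μ LinearMap.id t) := by
    intro t
    have : μ ∘ₗ TensorProduct.map LinearMap.id μ ∘ₗ α = μ ∘ₗ TensorProduct.map μ LinearMap.id := by
      refine TensorProduct.ext_threefold fun u v w => ?_
      simp [μ, α, mul_assoc]
    exact LinearMap.congr_fun this t
  have hmap : ∀ k, Commute X (TensorProduct.map (d k) 1 + TensorProduct.map 1 (d k)) := by
    intro k
    refine Commute.smul_left (Commute.sum_left _ _ _ fun l _ => Commute.add_right ?_ ?_) c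
    · exact commute_map (hdd _ _) (Commute.one_right _)
    · exact commute_map (Commute.one_right _) (hde _ _).symm
  have hmap' : ∀ k, Commute X (TensorProduct.map (e k) 1 + TensorProduct.map 1 (e k)) := by
    intro k
    refine Commute.smul_left (Commute.sum_left _ _ _ fun l _ => Commute.add_right ?_ ?_) c
    · exact commute_map (hde _ _) (Commute.one_right _)
    · exact commute_map (Commute.one_right _) (hee _ _)
  have hc : Commute Y X₁ := by
    refine Commute.smul_left (Commute.sum_left _ _ _ fun k _ => ?_) c
    rw [Commute, SemiconjBy, ← TensorProduct.map_mul, ← TensorProduct.map_mul, (hmap k).eq]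
    rfl
  have hc' : Commute Y' X₂ := by
    refine Commute.smul_left (Commute.sum_left _ _ _ fun k _ => ?_) c
    rw [Commute, SemiconjBy, ← TensorProduct.map_mul, ← TensorProduct.map_mul, (hmap' k).eq]
    rfl
  refine bilinSeries_assoc (fun r u v w => ?_) f g h
  have h1 : ∑ x ∈ antidiagonal r, tensorCoef X x.1 (tensorCoef X x.2 u v) w =
      μ (TensorProduct.map μ LinearMap.id (expCoef (Y + X₁) r ((u ⊗ₜ v) ⊗ₜ w))) := by
    rw [← sum_expCoef_mul_expCoef hc, LinearMap.sum_apply, map_sum, map_sum]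
    refine Finset.sum_congr rfl fun x _ => ?_
    have hx : X₁ ∘ₗ (TensorProduct.mk ℂ (A ⊗[ℂ] A) A).flip w =
      (TensorProduct.mk ℂ (A ⊗[ℂ] A) A).flip w ∘ₗ X := LinearMap.ext fun u => rfl
    rw [Module.End.mul_apply, ← expCoef_apply_of_comp_eq hY]
    have := expCoef_apply_of_comp_eq hx x.2 (u ⊗ₜ v)
    simp only [LinearMap.flip_apply, TensorProduct.mk_apply] at this
    rw [this, TensorProduct.map_tmul]
    rfl
  have h2 : ∑ x ∈ antidiagonal r, tensorCoef X x.1 u (tensorCoef X x.2 v w) =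
      μ (TensorProduct.map LinearMap.id μ (expCoef (Y' + X₂) r (u ⊗ₜ (v ⊗ₜ w)))) := by
    rw [← sum_expCoef_mul_expCoef hc', LinearMap.sum_apply, map_sum, map_sum]
    refine Finset.sum_congr rfl fun x _ => ?_
    have hx : X₂ ∘ₗ TensorProduct.mk ℂ A (A ⊗[ℂ] A) u =
      TensorProduct.mk ℂ A (A ⊗[ℂ] A) u ∘ₗ X := LinearMap.ext fun u => rfl
    rw [Module.End.mul_apply, ← expCoef_apply_of_comp_eq hY']
    have := expCoef_apply_of_comp_eq hx x.2 (v ⊗ₜ w)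
    simp only [TensorProduct.mk_apply] at this
    rw [this, TensorProduct.map_tmul]
    rfl
  rw [h1, h2, ← hμ, add_comm Y, ← expCoef_apply_of_comp_eq hα, add_comm Y']
  rfl

end TensorCoef

/-! ### Derivatives -/

theorem pderiv_apply {E : Type*} [NormedAddCommGroup E] [NormedSpace ℝ E] (v : E) (f : Smooth E)
    (x : E) : pderiv v f x = fderiv ℝ f.toFun x v := rfl

theorem pderiv_mul {E : Type*} [NormedAddCommGroup E] [NormedSpace ℝ E] (v : E) (f g : Smooth E) :
    pderiv v (f * g) = pderiv v f * g + f * pderiv v g := by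
  ext x
  have h : fderiv ℝ (f.toFun * g.toFun) x v = _ := congrArg (fun L => L v)
    (fderiv_mul (smooth_differentiable f x) (smooth_differentiable g x))
  refine h.trans ?_
  simp [pderiv_apply]
  ring

/-- Symmetry of the second derivative; every commutation of operators below rests on it. -/
theorem commute_pderiv {E : Type*} [NormedAddCommGroup E] [NormedSpace ℝ E] (v w : E) :
    Commute (pderiv v : Module.End ℂ (Smooth E)) (pderiv w) := by
  refine LinearMap.ext fun f => Smooth.ext fun x => ?_
  have h2 : ∀ v w : E, pderiv v (pderiv w f) x = fderiv ℝ (fderiv ℝ f.toFun) x v w := by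
    intro v w
    have hd : DifferentiableAt ℝ (fderiv ℝ f.toFun) x :=
      ((f.contDiff.fderiv_right (m := ∞) (by simp)).differentiable (by simp)) x
    have h : fderiv ℝ (fun y => fderiv ℝ f.toFun y w) x v = _ := congrArg (fun L => L v)
      (fderiv_clm_apply hd (differentiableAt_const w))
    refine h.trans ?_
    simp
  rw [Module.End.mul_apply, Module.End.mul_apply, h2, h2]
  refine (f.contDiff.contDiffAt.isSymmSndFDerivAt (n := ∞) ?_) v w
  rw [minSmoothness_of_isRCLikeNormedField]
  exact WithTop.coe_le_coe.mpr (le_top : (2 : ℕ∞) ≤ ⊤)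

theorem pderiv_pullback {E F : Type*} [NormedAddCommGroup E] [NormedSpace ℝ E]
    [NormedAddCommGroup F] [NormedSpace ℝ F] (L : E →L[ℝ] F) (v : E) (f : Smooth F) :
    pderiv v (pullback L f) = pullback L (pderiv (L v) f) := by
  ext x
  have h : fderiv ℝ (f.toFun ∘ L) x v = _ := congrArg (fun T => T v)
    (fderiv_comp x (smooth_differentiable f (L x)) L.differentiableAt)
  refine h.trans ?_
  rw [ContinuousLinearMap.fderiv]
  rfl

variable {n : ℕ}

/-! ### The standard ordered product -/

/-- The generator `(1 / i) ∑ k, ∂_{p_k} ⊗ ∂_{q^k}` of the standard ordered product. -/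
def stdGen (n : ℕ) : Module.End ℂ (Smooth (Phase n) ⊗[ℂ] Smooth (Phase n)) :=
  (1 / Complex.I) • ∑ k : Fin n, TensorProduct.map (dp k) (dq k)

/-- The standard ordered product. -/
def stdProd (f g : Obs n) : Obs n := bilinSeries (tensorCoef (stdGen n)) f g

theorem weylCoef_eq (r : ℕ) :
    weylCoef (n := n) r = tensorCoef ((Complex.I / 2) • poisson n) r := by
  rw [weylCoef, moyal, tensorCoef, expCoef_smul, LinearMap.comp_smul]
  rfl

theorem sCoef_eq (r : ℕ) : sCoef (n := n) r = expCoef ((-Complex.I / 2) • laplace n) r := by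
  rw [sCoef, expCoef_smul]

theorem commute_dq_dq (k l : Fin n) : Commute (dq k) (dq l) := commute_pderiv _ _
theorem commute_dp_dq (k l : Fin n) : Commute (dp k) (dq l) := commute_pderiv _ _
theorem commute_dq_dp (k l : Fin n) : Commute (dq k) (dp l) := commute_pderiv _ _
theorem commute_dp_dp (k l : Fin n) : Commute (dp k) (dp l) := commute_pderiv _ _

theorem commute_laplace_dq (k : Fin n) : Commute (laplace n) (dq k) :=
  Commute.sum_left _ _ _ fun l _ => (commute_dq_dq l k).mul_left (commute_dp_dq l k)

theorem commute_laplace_dp (k : Fin n) : Commute (laplace n) (dp k) :=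
  Commute.sum_left _ _ _ fun l _ => (commute_dq_dp l k).mul_left (commute_dp_dp l k)

theorem commute_map_poisson {a b : Module.End ℂ (Smooth (Phase n))}
    (haq : ∀ k, Commute a (dq k)) (hap : ∀ k, Commute a (dp k))
    (hbq : ∀ k, Commute b (dq k)) (hbp : ∀ k, Commute b (dp k)) :
    Commute (TensorProduct.map a b) (poisson n) :=
  Commute.sum_right _ _ _ fun k _ =>
    (commute_map (haq k) (hbp k)).sub_right (commute_map (hap k) (hbq k))

/-- The operator on `f ⊗ g` that induces `Δ` on the product `f g`. -/
def laplaceTensor (n : ℕ) : Module.End ℂ (Smooth (Phase n) ⊗[ℂ] Smooth (Phase n)) :=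
  TensorProduct.map (laplace n) 1 + TensorProduct.map 1 (laplace n) +
    ∑ k : Fin n, (TensorProduct.map (dq k) (dp k) + TensorProduct.map (dp k) (dq k))

/-- The Leibniz rule applied twice; the mixed terms of `laplaceTensor` are what separates Weyl from
standard ordering. -/
theorem laplace_comp_mul :
    laplace n ∘ₗ LinearMap.mul' ℂ (Smooth (Phase n)) =
      LinearMap.mul' ℂ (Smooth (Phase n)) ∘ₗ laplaceTensor n := by
  refine TensorProduct.ext' fun u v => ?_
  have hp : ∀ (k : Fin n) u v, dp k (u * v) = dp k u * v + u * dp k v :=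
    fun k => pderiv_mul _
  have hq : ∀ (k : Fin n) u v, dq k (u * v) = dq k u * v + u * dq k v :=
    fun k => pderiv_mul _
  simp only [laplace, laplaceTensor, LinearMap.comp_apply, LinearMap.mul'_apply,
    LinearMap.sum_apply, LinearMap.add_apply, TensorProduct.map_tmul, Module.End.mul_apply,
    Module.End.one_apply, hp, hq, map_add, map_sum, Finset.sum_mul, Finset.mul_sum,
    ← Finset.sum_add_distrib]
  refine Finset.sum_congr rfl fun k _ => ?_
  ring

theorem commute_laplaceTensor_poisson : Commute (laplaceTensor n) (poisson n) := by
  refine ((Commute.add_left ?_ ?_).add_left (Commute.sum_left _ _ _ fun k _ =>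
    Commute.add_left ?_ ?_))
  · exact commute_map_poisson commute_laplace_dq commute_laplace_dp
      (fun _ => Commute.one_left _) (fun _ => Commute.one_left _)
  · exact commute_map_poisson (fun _ => Commute.one_left _) (fun _ => Commute.one_left _)
      commute_laplace_dq commute_laplace_dp
  · exact commute_map_poisson (commute_dq_dq k) (commute_dq_dp k) (commute_dp_dq k)
      (commute_dp_dp k)
  · exact commute_map_poisson (commute_dp_dq k) (commute_dp_dp k) (commute_dq_dq k)
      (commute_dq_dp k)

theorem commute_stdGen_map {a b : Module.End ℂ (Smooth (Phase n))}
    (ha : ∀ k, Commute a (dp k)) (hb : ∀ k, Commute b (dq k)) :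
    Commute (stdGen n) (TensorProduct.map a b) :=
  Commute.smul_left (Commute.sum_left _ _ _ fun k _ =>
    commute_map (ha k).symm (hb k).symm) _

theorem star_eq (f g : Obs n) :
    star f g = bilinSeries (tensorCoef ((Complex.I / 2) • poisson n)) f g :=
  bilinSeries_congr fun r _ _ => by rw [weylCoef_eq]

theorem opS_eq (f : Obs n) : opS f = opSeries (expCoef ((-Complex.I / 2) • laplace n)) f :=
  Laurent.ext fun k => finsum_congr fun r => by rw [sCoef_eq]

/-- `𝒮` intertwines the Weyl product and the standard ordered product. -/
theorem opS_star (f g : Obs n) : opS (star f g) = stdProd (opS f) (opS g) := by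
  have hc : Commute ((-Complex.I / 2) • laplaceTensor n) ((Complex.I / 2) • poisson n) :=
    (commute_laplaceTensor_poisson.smul_left _).smul_right _
  have hS : ((-Complex.I / 2) • laplace n) ∘ₗ LinearMap.mul' ℂ (Smooth (Phase n)) =
      LinearMap.mul' ℂ (Smooth (Phase n)) ∘ₗ ((-Complex.I / 2) • laplaceTensor n) := by
    rw [LinearMap.smul_comp, laplace_comp_mul, LinearMap.comp_smul]
  have h1 : Commute (stdGen n) (TensorProduct.map ((-Complex.I / 2) • laplace n) 1) :=
    commute_stdGen_map (fun k => (commute_laplace_dp k).smul_left _)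
      (fun _ => Commute.one_left _)
  have h2 : Commute (stdGen n + TensorProduct.map ((-Complex.I / 2) • laplace n) 1)
      (TensorProduct.map 1 ((-Complex.I / 2) • laplace n)) :=
    (commute_stdGen_map (fun _ => Commute.one_left _)
      (fun k => (commute_laplace_dq k).smul_left _)).add_left
      (commute_map (Commute.one_right _) (Commute.one_left _))
  rw [opS_eq, opS_eq, opS_eq, star_eq, stdProd, opSeries_expCoef_tensorCoef hS hc,
    bilinSeries_tensorCoef_expCoef_left h1, bilinSeries_tensorCoef_expCoef_right h2]
  -- Each side is a single exponential, so only generators are compared: the `∂_q ⊗ ∂_p` terms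
  -- cancel and the `∂_p ⊗ ∂_q` terms add up to `-i = 1/i`.
  congr 2
  refine TensorProduct.ext' fun u v => ?_
  simp only [laplaceTensor, poisson, stdGen, LinearMap.add_apply, LinearMap.smul_apply,
    LinearMap.sum_apply, LinearMap.sub_apply, TensorProduct.map_tmul, Module.End.one_apply,
    TensorProduct.tmul_smul, ← TensorProduct.smul_tmul', Finset.sum_add_distrib,
    Finset.sum_sub_distrib, one_div, Complex.inv_I]
  module

theorem stdProd_assoc (f g h : Obs n) :
    stdProd (stdProd f g) h = stdProd f (stdProd g h) :=
  bilinSeries_tensorCoef_assoc (fun _ => pderiv_mul _) (fun _ => pderiv_mul _) commute_dp_dp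
    commute_dp_dq commute_dq_dq _ f g h

/-! ### Restriction to the zero section -/

/-- Restriction to the zero section, coefficientwise. -/
def restrL (f : Obs n) : Laurent (Smooth (Config n)) :=
  mapCoef (restr : Smooth (Phase n) →ₗ[ℂ] Smooth (Config n)).toAddMonoidHom.toZeroHom f

/-- The direction `q^k` is tangent to the zero section. -/
theorem restr_dq (k : Fin n) (f : Smooth (Phase n)) : restr (dq k f) = dconf k (restr f) :=
  (pderiv_pullback (zeroSection n) (Pi.single k 1) f).symm

theorem restr_mul (f g : Smooth (Phase n)) : restr (f * g) = restr f * restr g := rfl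

/-- Expanding the power gives one word per index tuple, in the same order in both factors, so no
commutativity is needed. -/
theorem sum_map_pow {ι R M N : Type*} [Fintype ι] [CommRing R] [AddCommGroup M] [Module R M]
    [AddCommGroup N] [Module R N] (d : ι → Module.End R M) (e : ι → Module.End R N) (r : ℕ) :
    (∑ k, TensorProduct.map (d k) (e k)) ^ r = ∑ I : Fin r → ι, TensorProduct.map
      (List.ofFn fun j => d (I j)).prod (List.ofFn fun j => e (I j)).prod := by
  induction r with
  | zero => simp
  | succ r ih =>
    rw [pow_succ', ih, Finset.sum_mul_sum, ← Fintype.sum_prod_type',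
      ← (Fin.consEquiv fun _ => ι).sum_comp]
    refine Finset.sum_congr rfl fun x _ => ?_
    simp [Fin.consEquiv, List.ofFn_succ, TensorProduct.map_mul]

theorem restr_prod_dq {r : ℕ} (I : Fin r → Fin n) (g : Smooth (Phase n)) :
    restr ((List.ofFn fun j => dq (I j)).prod g) = dconfMulti I (restr g) := by
  induction r with
  | zero => simp [dconfMulti]
  | succ r ih =>
    have := ih fun j => I j.succ
    rw [dconfMulti] at this ⊢
    rw [List.ofFn_succ, List.ofFn_succ, List.prod_cons, List.prod_cons, Module.End.mul_apply,
      Module.End.mul_apply, restr_dq, this]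

/-- The factor `g` only meets `q`-derivatives, which pass through the restriction; thus only `restr
g` matters. -/
theorem restr_stdCoef (r : ℕ) (f g : Smooth (Phase n)) :
    restr (tensorCoef (stdGen n) r f g) = schrCoef r f (restr g) := by
  rw [tensorCoef_apply, stdGen, expCoef_smul, sum_map_pow, schrCoef]
  simp only [LinearMap.smul_apply, LinearMap.sum_apply, map_smul, map_sum,
    TensorProduct.map_tmul, LinearMap.mul'_apply, restr_mul, restr_prod_dq]
  rfl

/-- Restriction to the zero section turns the standard ordered product into the Schrödinger
action. -/
theorem restrL_stdProd (f g : Obs n) :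
    restrL (stdProd f g) = bilinSeries schrCoef f (restrL g) :=
  mapCoef_bilinSeries restr fun r _ _ => restr_stdCoef r _ _

/-! ### Lifts and the unit -/

theorem dp_lift (k : Fin n) (φ : Smooth (Config n)) : dp k (lift φ) = 0 := by
  refine (pderiv_pullback _ _ φ).trans ?_
  ext x
  exact map_zero (fderiv ℝ φ.toFun x.1)

theorem opS_of_laplace_eq_zero {f : Obs n} (h : ∀ k, laplace n (coef f k) = 0) : opS f = f := by
  refine Laurent.ext fun k => ?_
  refine (finsum_eq_single _ 0 fun r hr => ?_).trans ?_
  · obtain ⟨s, rfl⟩ := Nat.exists_eq_succ_of_ne_zero hr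
    simp [sCoef, pow_succ, h]
  · simp [sCoef]

theorem star_one_left (g : Obs n) : star one g = g := by
  have h0 : ∀ r, r ≠ 0 → ∀ v : Smooth (Phase n), weylCoef r 1 v = 0 := by
    intro r hr v
    obtain ⟨s, rfl⟩ := Nat.exists_eq_succ_of_ne_zero hr
    have h1 : ∀ w : Phase n, pderiv w (1 : Smooth (Phase n)) = 0 := by
      intro w
      -- A derivation `D` kills `1`, since `1 = 1 · 1` gives `D 1 = D 1 + D 1`.
      have := pderiv_mul w (1 : Smooth (Phase n)) 1
      simpa using this
    have hP : poisson n (1 ⊗ₜ v) = 0 := by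
      simp [poisson, dq, dp, h1]
    simp [weylCoef, moyal, pow_succ, hP]
  have hone : ∀ a : ℤ, coef (one : Obs n) a = if a = 0 then 1 else 0 := by
    intro a
    refine HahnSeries.coeff_one.trans ?_
    split_ifs <;> rfl
  refine Laurent.ext fun k => ?_
  refine (finsum_eq_single _ (0, 0) fun x hx => ?_).trans ?_
  · rw [hone]
    split_ifs with hx0
    · exact h0 _ (fun h => hx (Prod.ext h hx0)) _
    · simp
  · simp [hone, weylCoef, moyal]

/-! ### Integration -/

theorem integrable_of_mem_compactSmooth {φ : Smooth (Config n)} (h : φ ∈ compactSmooth n) :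
    MeasureTheory.Integrable φ.toFun :=
  φ.contDiff.continuous.integrable_of_hasCompactSupport h

theorem integral_pderiv_eq_zero (v : Config n) {φ : Smooth (Config n)}
    (h : φ ∈ compactSmooth n) : ∫ q, pderiv v φ q = 0 := by
  have hφ := integrable_of_mem_compactSmooth h
  have hφ' := integrable_of_mem_compactSmooth (pderiv_mem_compactSmooth v h)
  -- Integration by parts against the constant function `1`.
  have := integral_mul_fderiv_eq_neg_fderiv_mul_of_integrable (μ := MeasureTheory.volume)
    (f := fun _ : Config n => (1 : ℂ)) (g := φ.toFun) (v := v) (by simp)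
    (by simp only [one_mul]; exact hφ') (by simpa using hφ) (fun _ _ => differentiableAt_const _)
    (fun x _ => smooth_differentiable φ x)
  simp only [one_mul, fderiv_fun_const, Pi.zero_apply, zero_apply, zero_mul,
    MeasureTheory.integral_zero, neg_zero] at this
  exact this

/-- There is a linear functional on all smooth functions that extends the integral. -/
theorem exists_integral_extension (n : ℕ) : ∃ I : Smooth (Config n) →ₗ[ℂ] ℂ,
    ∀ φ ∈ compactSmooth n, I φ = ∫ q, φ q := by
  let I₀ : compactSmooth n →ₗ[ℂ] ℂ :=
    { toFun := fun φ => ∫ q, φ.1 q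
      map_add' := fun φ ψ => MeasureTheory.integral_add (integrable_of_mem_compactSmooth φ.2)
        (integrable_of_mem_compactSmooth ψ.2)
      map_smul' := fun c φ => MeasureTheory.integral_const_mul c _ }
  -- Any extension serves: only its values on compactly supported functions are used, but a
  -- functional defined everywhere can be composed with the operators.
  obtain ⟨I, hI⟩ := LinearMap.exists_extend I₀
  exact ⟨I, fun φ hφ => LinearMap.congr_fun hI ⟨φ, hφ⟩⟩

theorem integral_eq_of_coef {φ ψ : Wave n}
    (h : ∀ k, ∫ q, coef (φ : Laurent (Smooth (Config n))) k q =
      ∫ q, coef (ψ : Laurent (Smooth (Config n))) k q) : integral φ = integral ψ :=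
  congrArg CLaurent.ofSeries (HahnSeries.ext (funext h))

/-- The span of the tensors `f ⊗ g` with `g ∈ C^∞(T*ℝⁿ)_{ℝⁿ}`. -/
def tensorZeroCompact (n : ℕ) : Submodule ℂ (Smooth (Phase n) ⊗[ℂ] Smooth (Phase n)) :=
  Submodule.span ℂ {t | ∃ a, ∃ b ∈ zeroCompact n, a ⊗ₜ[ℂ] b = t}

theorem map_mem_tensorZeroCompact (a : Module.End ℂ (Smooth (Phase n)))
    {b : Module.End ℂ (Smooth (Phase n))} (hb : ∀ g ∈ zeroCompact n, b g ∈ zeroCompact n)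
    {t : Smooth (Phase n) ⊗[ℂ] Smooth (Phase n)} (ht : t ∈ tensorZeroCompact n) :
    TensorProduct.map a b t ∈ tensorZeroCompact n := by
  have : tensorZeroCompact n ≤ (tensorZeroCompact n).comap (TensorProduct.map a b) := by
    refine Submodule.span_le.mpr ?_
    rintro _ ⟨u, v, hv, rfl⟩
    exact Submodule.subset_span ⟨_, _, hb v hv, rfl⟩
  exact this ht

theorem poisson_mem_tensorZeroCompact {t : Smooth (Phase n) ⊗[ℂ] Smooth (Phase n)}
    (ht : t ∈ tensorZeroCompact n) : poisson n t ∈ tensorZeroCompact n := by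
  rw [poisson, LinearMap.sum_apply]
  exact Submodule.sum_mem _ fun k _ => Submodule.sub_mem _
    (map_mem_tensorZeroCompact _ (fun _ => pderiv_mem _) ht)
    (map_mem_tensorZeroCompact _ (fun _ => pderiv_mem _) ht)

/-- The operator `Δ ⊗ 1 - 1 ⊗ Δ`. -/
def laplaceDiff (n : ℕ) : Module.End ℂ (Smooth (Phase n) ⊗[ℂ] Smooth (Phase n)) :=
  TensorProduct.map (laplace n) 1 - TensorProduct.map 1 (laplace n)

theorem laplace_mem {f : Smooth (Phase n)} (hf : f ∈ zeroCompact n) :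
    laplace n f ∈ zeroCompact n := by
  simpa using laplace_pow_mem 1 hf

theorem laplaceDiff_mem_tensorZeroCompact {t : Smooth (Phase n) ⊗[ℂ] Smooth (Phase n)}
    (ht : t ∈ tensorZeroCompact n) : laplaceDiff n t ∈ tensorZeroCompact n := by
  rw [laplaceDiff, LinearMap.sub_apply]
  exact Submodule.sub_mem _ (map_mem_tensorZeroCompact _ (fun _ h => by simpa using h) ht)
    (map_mem_tensorZeroCompact _ (fun _ => laplace_mem) ht)

theorem commute_laplaceDiff_poisson : Commute (laplaceDiff n) (poisson n) :=
  (commute_map_poisson commute_laplace_dq commute_laplace_dp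
    (fun _ => Commute.one_left _) (fun _ => Commute.one_left _)).sub_left
    (commute_map_poisson (fun _ => Commute.one_left _) (fun _ => Commute.one_left _)
      commute_laplace_dq commute_laplace_dp)

/-- Integration by parts: under `∫ i*`, the Poisson operator may be replaced by
`Δ ⊗ 1 - 1 ⊗ Δ`. -/
theorem integral_restr_mul_poisson {I : Smooth (Config n) →ₗ[ℂ] ℂ}
    (hI : ∀ φ ∈ compactSmooth n, I φ = ∫ q, φ q)
    {t : Smooth (Phase n) ⊗[ℂ] Smooth (Phase n)} (ht : t ∈ tensorZeroCompact n) :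
    I (restr (LinearMap.mul' ℂ _ (poisson n t))) =
      I (restr (LinearMap.mul' ℂ _ (laplaceDiff n t))) := by
  have key : tensorZeroCompact n ≤ LinearMap.eqLocus
      (I ∘ₗ restr ∘ₗ LinearMap.mul' ℂ _ ∘ₗ poisson n)
      (I ∘ₗ restr ∘ₗ LinearMap.mul' ℂ _ ∘ₗ laplaceDiff n) := by
    refine Submodule.span_le.mpr ?_
    rintro _ ⟨u, v, hv, rfl⟩
    refine sub_eq_zero.mp ?_
    have hq : ∀ (k : Fin n) u v, dq k (u * v) = dq k u * v + u * dq k v :=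
      fun k => pderiv_mul _
    -- The two integrands differ by a total `q`-derivative, and the support condition on `v` makes
    -- its restriction compactly supported.
    have e : LinearMap.mul' ℂ _ (poisson n (u ⊗ₜ v)) - LinearMap.mul' ℂ _ (laplaceDiff n (u ⊗ₜ v))
        = ∑ k : Fin n, dq k (u * dp k v - dp k u * v) := by
      simp only [poisson, laplaceDiff, laplace, LinearMap.sum_apply, LinearMap.sub_apply,
        TensorProduct.map_tmul, Module.End.mul_apply, Module.End.one_apply, map_sub, map_sum,
        LinearMap.mul'_apply, hq, Finset.sum_mul, Finset.mul_sum, ← Finset.sum_sub_distrib]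
      refine Finset.sum_congr rfl fun k _ => ?_
      ring
    simp only [LinearMap.comp_apply]
    rw [← map_sub, ← map_sub, e, map_sum, map_sum]
    refine Finset.sum_eq_zero fun k _ => ?_
    have hm : restr (u * dp k v - dp k u * v) ∈ compactSmooth n :=
      restr_mem (Submodule.sub_mem _ (mul_mem_zeroCompact _ (pderiv_mem _ hv))
        (mul_mem_zeroCompact _ hv))
    rw [restr_dq, dconf, hI _ (pderiv_mem_compactSmooth _ hm)]
    exact integral_pderiv_eq_zero _ hm
  exact key ht

/-- The outermost Poisson operator is traded for `laplaceDiff`, which commutes with the remaining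
ones and is moved inside onto `t`; then the induction hypothesis applies. -/
theorem integral_restr_mul_poisson_pow {I : Smooth (Config n) →ₗ[ℂ] ℂ}
    (hI : ∀ φ ∈ compactSmooth n, I φ = ∫ q, φ q) (r : ℕ)
    {t : Smooth (Phase n) ⊗[ℂ] Smooth (Phase n)} (ht : t ∈ tensorZeroCompact n) :
    I (restr (LinearMap.mul' ℂ _ ((poisson n ^ r) t))) =
      I (restr (LinearMap.mul' ℂ _ ((laplaceDiff n ^ r) t))) := by
  induction r generalizing t with
  | zero => rfl
  | succ r ih =>
    have hr : (poisson n ^ r) t ∈ tensorZeroCompact n := by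
      clear ih
      induction r with
      | zero => exact ht
      | succ r ih =>
        rw [pow_succ']
        exact poisson_mem_tensorZeroCompact ih
    rw [pow_succ', Module.End.mul_apply, integral_restr_mul_poisson hI hr,
      ← Module.End.mul_apply, (commute_laplaceDiff_poisson.pow_right r).eq,
      Module.End.mul_apply, ih (laplaceDiff_mem_tensorZeroCompact ht), pow_succ,
      Module.End.mul_apply]

/-! ### The pairing -/

/-- `𝒮⁻¹ = exp ((i λ / 2) Δ)`. -/
def opSInv (f : Obs n) : Obs n := opSeries (expCoef ((Complex.I / 2) • laplace n)) f

theorem mulL_restrL (f g : Obs n) : mulL (restrL f) (restrL g) = restrL (mulL f g) := by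
  rw [mulL_eq_bilinSeries, mulL_eq_bilinSeries]
  refine (mapCoef_bilinSeries restr fun r a b => ?_).symm
  by_cases hr : r = 0
  · subst hr
    simp only [constBilin, Pi.single_eq_same]
    exact restr_mul _ _
  · simp [constBilin, Pi.single_eq_of_ne hr]

/-- The pointwise product is the case of zero generator, which opens it to the rules for adding
exponents. -/
theorem mulL_eq_tensorCoef (f g : Obs n) : mulL f g = bilinSeries (tensorCoef 0) f g := by
  rw [mulL_eq_bilinSeries]
  refine bilinSeries_congr fun r a b => ?_
  rw [tensorCoef_apply, expCoef]
  by_cases hr : r = 0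
  · subst hr
    simp [constBilin]
  · simp [constBilin, Pi.single_eq_of_ne hr, zero_pow hr]

theorem mulL_opSInv_opS (f g : Obs n) : mulL (opSInv f) (opS g) =
    bilinSeries (tensorCoef ((Complex.I / 2) • laplaceDiff n)) f g := by
  rw [mulL_eq_tensorCoef, opSInv, opS_eq,
    bilinSeries_tensorCoef_expCoef_left (Commute.zero_left _),
    bilinSeries_tensorCoef_expCoef_right]
  · congr 2
    refine TensorProduct.ext' fun u v => ?_
    simp only [laplaceDiff, LinearMap.add_apply, LinearMap.smul_apply, LinearMap.zero_apply,
      LinearMap.sub_apply, TensorProduct.map_tmul, Module.End.one_apply,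
      TensorProduct.tmul_smul, ← TensorProduct.smul_tmul']
    module
  · exact (Commute.zero_left _).add_left
      (commute_map (Commute.one_right _) (Commute.one_left _))

/-- Integration by parts in every order of `λ`: under the integral the exponent `(i/2)` times the
Poisson operator becomes `(i/2)(Δ ⊗ 1 - 1 ⊗ Δ)`, which factors as `𝒮⁻¹ ⊗ 𝒮`. -/
theorem integral_restr_star (f : Obs n) (g : ObsZ n) {φ ψ : Wave n}
    (hφ : (φ : Laurent (Smooth (Config n))) = restrL (star f g))
    (hψ : (ψ : Laurent (Smooth (Config n))) = mulL (restrL (opSInv f)) (restrL (opS g))) :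
    integral φ = integral ψ := by
  obtain ⟨I, hI⟩ := exists_integral_extension n
  have hT : mapCoef (I ∘ₗ restr).toAddMonoidHom.toZeroHom (star f g) =
      mapCoef (I ∘ₗ restr).toAddMonoidHom.toZeroHom (mulL (opSInv f) (opS g)) := by
    rw [star_eq, mulL_opSInv_opS]
    refine (mapCoef_bilinSeries _ (B' := fun r =>
      (tensorCoef ((Complex.I / 2) • laplaceDiff n) r).compr₂ (I ∘ₗ restr)) fun r a b => ?_).trans
      (mapCoef_bilinSeries _ fun r a b => rfl).symm
    have ht : coef f a ⊗ₜ[ℂ] coef (g : Obs n) b ∈ tensorZeroCompact n :=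
      Submodule.subset_span ⟨_, _, g.2 b, rfl⟩
    simp only [tensorCoef_apply, expCoef_smul, LinearMap.compr₂_apply, LinearMap.comp_apply,
      LinearMap.smul_apply, map_smul, integral_restr_mul_poisson_pow hI r ht]
  refine integral_eq_of_coef fun k => ?_
  rw [← hI _ (φ.2 k), ← hI _ (ψ.2 k), hφ, hψ, mulL_restrL]
  exact congrArg (fun F => coef F k) hT

/-! ### Complex conjugation -/

theorem conjFun_apply {E : Type*} [NormedAddCommGroup E] [NormedSpace ℝ E] (f : Smooth E) (x : E) :
    conjFun f x = conj (f x) := rfl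

theorem conjFun_pderiv {E : Type*} [NormedAddCommGroup E] [NormedSpace ℝ E] (v : E)
    (f : Smooth E) : conjFun (pderiv v f) = pderiv v (conjFun f) := by
  ext x
  have h : fderiv ℝ (Complex.conjCLE ∘ f.toFun) x v = _ := congrArg (fun L => L v)
    (Complex.conjCLE.comp_fderiv (f := f.toFun) (x := x))
  exact h.symm

/-- Complex conjugation as an additive map. -/
def conjAdd (E : Type*) [NormedAddCommGroup E] [NormedSpace ℝ E] : Smooth E →+ Smooth E where
  toFun := conjFun
  map_zero' := map_zero _
  map_add' f g := Smooth.ext fun x => map_add (starRingEnd ℂ) (f x) (g x)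

theorem conjAdd_injective (E : Type*) [NormedAddCommGroup E] [NormedSpace ℝ E] :
    Function.Injective (conjAdd E) := by
  refine Function.LeftInverse.injective (g := conjAdd E) fun f => Smooth.ext fun x => ?_
  exact Complex.conj_conj _

theorem conjFun_laplace (f : Smooth (Phase n)) : conjFun (laplace n f) = laplace n (conjFun f) := by
  rw [laplace, LinearMap.sum_apply, LinearMap.sum_apply]
  refine (map_sum (conjAdd _) _ _).trans (Finset.sum_congr rfl fun k _ => ?_)
  exact (conjFun_pderiv _ _).trans (congrArg _ (conjFun_pderiv _ _))

theorem conjFun_sCoef (r : ℕ) (f : Smooth (Phase n)) :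
    conjFun (sCoef r f) = expCoef ((Complex.I / 2) • laplace n) r (conjFun f) := by
  have hp : ∀ r, conjFun ((laplace n ^ r) f) = (laplace n ^ r) (conjFun f) := by
    intro r
    induction r with
    | zero => rfl
    | succ r ih => rw [pow_succ', Module.End.mul_apply, conjFun_laplace, ih, Module.End.mul_apply]
  rw [sCoef, expCoef_smul, LinearMap.smul_apply, LinearMap.smul_apply, ← hp]
  ext x
  simp [conjFun_apply, map_ofNat]

/-- `Δ` and `λ` are real, so conjugation only changes the sign of `i`. Conjugation is injective, so
it passes through `finsum` with no finiteness argument. -/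
theorem conjL_opS (f : Obs n) : conjL (opS f) = opSInv (conjL f) := by
  refine Laurent.ext fun k => ?_
  exact ((conjAdd (Phase n)).map_finsum_of_injective (conjAdd_injective _) _).trans
    (finsum_congr fun r => conjFun_sCoef _ _)

/-- The GNS pairing is the `L²` product of the functions `i* 𝒮 f`. -/
theorem gnsPairing_eq_l2 (f g : ObsZ n) : gnsPairing f g = l2 (restrS f) (restrS g) := by
  refine integral_restr_star (conjL (f : Obs n)) g rfl ?_
  rw [← conjL_opS]
  rfl

/-! ### Positivity -/

theorem eq_zero_of_integral_conj_mul_self {φ : Smooth (Config n)} (hφ : φ ∈ compactSmooth n)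
    (h : ∫ q, (conjFun φ * φ) q = 0) : φ = 0 := by
  ext x
  by_contra hx
  have h1 : ∀ q, (conjFun φ * φ) q = ((‖φ q‖ ^ 2 : ℝ) : ℂ) := by
    intro q
    rw [Smooth.mul_apply, conjFun_apply, Complex.conj_mul']
    push_cast
    rfl
  simp only [h1] at h
  rw [integral_complex_ofReal, Complex.ofReal_eq_zero] at h
  have hcont : Continuous fun q => ‖φ q‖ ^ 2 := φ.contDiff.continuous.norm.pow 2
  have hsupp : HasCompactSupport fun q => ‖φ q‖ ^ 2 :=
    HasCompactSupport.comp_left (g := fun z : ℂ => ‖z‖ ^ 2) hφ (by simp)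
  exact (hcont.integral_pos_of_hasCompactSupport_nonneg_nonzero hsupp
    (fun q => sq_nonneg ‖φ q‖) (pow_ne_zero 2 (norm_ne_zero_iff.mpr hx))).ne' h

/-- If `m` is the lowest degree of a nonzero `φ`, the coefficient of `⟨φ, φ⟩` in degree `2m` is the
squared `L²` norm of the leading coefficient, hence nonzero. -/
theorem l2_self_eq_zero {φ : Wave n} : l2 φ φ = 0 ↔ φ = 0 := by
  refine ⟨fun h => ?_, fun h => ?_⟩
  · by_contra hne
    set F : Laurent (Smooth (Config n)) := (φ : Laurent (Smooth (Config n))) with hF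
    have hF0 : toHahn F ≠ 0 := fun h0 => hne (Subtype.ext (toHahn.injective h0))
    set m := (toHahn F).order with hm
    have hlow : ∀ k, coef F k ≠ 0 → m ≤ k := fun k hk => HahnSeries.order_le_of_coeff_ne_zero hk
    have hm0 : coef F m ≠ 0 := by
      have := HahnSeries.leadingCoeff_ne_zero.mpr hF0
      rwa [HahnSeries.leadingCoeff_eq] at this
    refine hm0 (eq_zero_of_integral_conj_mul_self (φ.2 m) ?_)
    -- Both degrees are at least `m`, so `(m, m)` is the only pair that adds up to `m + m`.
    have hc : coef (mulL (conjL F) F) (m + m) = conjFun (coef F m) * coef F m := by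
      rw [mulL_eq_bilinSeries, coef_bilinSeries_constBilin _ _ _ _ {(m, m)} (by simp)]
      · simp [conjL]
      · intro i j hij hi hj
        have h1 : m ≤ i := hlow i fun h0 => hi (by simp [conjL, h0])
        have h2 := hlow j hj
        rw [Finset.mem_singleton]
        ext <;> simp only <;> omega
    rw [← hc]
    exact congrArg (fun c => (CLaurent.ofSeries.symm c).coeff (m + m)) h
  · subst h
    refine congrArg CLaurent.ofSeries (HahnSeries.ext (funext fun k => ?_))
    have : mulL (conjL (0 : Laurent (Smooth (Config n)))) 0 = 0 := by
      simp [mulL]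
    change ∫ q, coef (mulL (conjL (0 : Laurent (Smooth (Config n)))) 0) k q = 0
    rw [this]
    simp

/-! ### The GNS representation -/

theorem restrL_add (f g : Obs n) : restrL (f + g) = restrL f + restrL g :=
  Laurent.ext fun _ => map_add restr _ _

theorem restrL_smul (c : CLaurent) (f : Obs n) : restrL (c • f) = c • restrL f := by
  rw [smul_eq_bilinSeries, smul_eq_bilinSeries]
  refine mapCoef_bilinSeries restr fun r a b => ?_
  by_cases hr : r = 0
  · subst hr
    simp [constBilin, restrL]
  · simp [constBilin, Pi.single_eq_of_ne hr]

/-- `g ↦ i* 𝒮 g` as a linear map. -/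
def restrSLin (n : ℕ) : ObsZ n →ₗ[CLaurent] Wave n where
  toFun := restrS
  map_add' _ _ := Subtype.ext <|
    (congrArg restrL (opSeries_add _ _ _)).trans (restrL_add _ _)
  map_smul' _ _ := Subtype.ext <|
    (congrArg restrL (opSeries_smul _ _ _)).trans (restrL_smul _ _)

/-- The Schrödinger representation as a bilinear map. -/
def schroedingerLin (n : ℕ) : Obs n →ₗ[CLaurent] Module.End CLaurent (Wave n) :=
  LinearMap.mk₂ CLaurent schroedinger
    (fun _ _ _ => Subtype.ext <|
      (congrArg (fun F => bilinSeries schrCoef F _) (opSeries_add _ _ _)).trans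
        (bilinSeries_add_left _ _ _ _))
    (fun _ _ _ => Subtype.ext <|
      (congrArg (fun F => bilinSeries schrCoef F _) (opSeries_smul _ _ _)).trans
        (bilinSeries_smul_left _ _ _ _))
    (fun _ _ _ => Subtype.ext <| bilinSeries_add_right _ _ _ _)
    (fun _ _ _ => Subtype.ext <| bilinSeries_smul_right _ _ _ _)

theorem restrS_starZ (f : Obs n) (g : ObsZ n) :
    restrS (starZ f g) = schroedinger f (restrS g) :=
  Subtype.ext <| (congrArg restrL (opS_star f g)).trans (restrL_stdProd _ _)

theorem restrS_liftL (φ : Wave n) : restrS (liftL φ) = φ := by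
  have h : opS (liftL φ : Obs n) = liftL φ := by
    refine opS_of_laplace_eq_zero fun k => ?_
    rw [laplace, LinearMap.sum_apply]
    refine Finset.sum_eq_zero fun j _ => ?_
    exact (congrArg (dq j) (dp_lift j (coef (φ : Laurent (Smooth (Config n))) k))).trans
      (map_zero _)
  exact Subtype.ext (congrArg restrL h)

/-- Associativity of the Weyl product is needed only after `𝒮` has been applied, where it becomes
that of the standard ordered product; no inverse of `𝒮` enters. -/
theorem restrS_star_star (f g : Obs n) (h : ObsZ n) :
    restrS (starZ (star f g) h) = restrS (starZ f (starZ g h)) := by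
  refine Subtype.ext (congrArg restrL ?_)
  change opS (star (star f g) h) = opS (star f (star g h))
  rw [opS_star, opS_star, opS_star, opS_star, stdProd_assoc]

/-- Every `φ` has the form `i*𝒮g`, so the Schrödinger action inherits the module law from the star
product. -/
theorem schroedinger_star (f g : Obs n) (φ : Wave n) :
    schroedinger (star f g) φ = schroedinger f (schroedinger g φ) := by
  rw [← restrS_liftL φ, ← restrS_starZ, ← restrS_starZ, ← restrS_starZ, restrS_star_star]

theorem schroedinger_one (φ : Wave n) : schroedinger one φ = φ := by
  rw [← restrS_liftL φ, ← restrS_starZ]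
  exact congrArg restrS (Subtype.ext (star_one_left _))

end WeylGNS

end

/-! ### The GNS representation of `ω₀` -/

theorem mainTheorem2 (n : ℕ) :
    ∃ J₀ : Submodule WeylGNS.CLaurent (WeylGNS.ObsZ n),
      (J₀ : Set (WeylGNS.ObsZ n)) = WeylGNS.gelfandSet n ∧
      (∀ g : WeylGNS.ObsZ n, g ∈ J₀ ↔ WeylGNS.restrS g = 0) ∧
      (∀ (f : WeylGNS.Obs n), ∀ g ∈ J₀, WeylGNS.starZ f g ∈ J₀) ∧
      ∃ (Φ : (WeylGNS.ObsZ n ⧸ J₀) ≃ₗ[WeylGNS.CLaurent] WeylGNS.Wave n)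
        (inn : (WeylGNS.ObsZ n ⧸ J₀) → (WeylGNS.ObsZ n ⧸ J₀) → WeylGNS.CLaurent)
        (π : WeylGNS.Obs n →ₗ[WeylGNS.CLaurent]
          Module.End WeylGNS.CLaurent (WeylGNS.ObsZ n ⧸ J₀)),
        (∀ g : WeylGNS.ObsZ n, Φ (J₀.mkQ g) = WeylGNS.restrS g) ∧
        (∀ φ : WeylGNS.Wave n, Φ.symm φ = J₀.mkQ (WeylGNS.liftL φ)) ∧
        (∀ g h : WeylGNS.ObsZ n, inn (J₀.mkQ g) (J₀.mkQ h) = WeylGNS.gnsPairing g h) ∧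
        (∀ φ ψ : WeylGNS.Wave n, inn (Φ.symm φ) (Φ.symm ψ) = WeylGNS.l2 φ ψ) ∧
        (∀ (f : WeylGNS.Obs n) (g : WeylGNS.ObsZ n),
          π f (J₀.mkQ g) = J₀.mkQ (WeylGNS.starZ f g)) ∧
        π WeylGNS.one = 1 ∧
        (∀ f g : WeylGNS.Obs n, π (WeylGNS.star f g) = π f * π g) ∧
        (∀ (f : WeylGNS.Obs n) (φ : WeylGNS.Wave n),
          Φ (π f (Φ.symm φ)) = WeylGNS.restrS (WeylGNS.starZ f (WeylGNS.liftL φ)) ∧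
          Φ (π f (Φ.symm φ)) = WeylGNS.schroedinger f φ) := by
  let R := WeylGNS.restrSLin n
  have hmem : ∀ g, g ∈ LinearMap.ker R ↔ WeylGNS.restrS g = 0 := fun g => LinearMap.mem_ker
  have hR : Function.Surjective R := fun φ => ⟨WeylGNS.liftL φ, WeylGNS.restrS_liftL φ⟩
  let Φ := R.quotKerEquivOfSurjective hR
  have hΦ : ∀ g, Φ ((LinearMap.ker R).mkQ g) = WeylGNS.restrS g := fun g => rfl
  -- The representation is the Schrödinger action transported along `Φ`; that it is induced by left
  -- star multiplication then follows from `restrS_starZ`.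
  let π : WeylGNS.Obs n →ₗ[WeylGNS.CLaurent]
      Module.End WeylGNS.CLaurent (WeylGNS.ObsZ n ⧸ LinearMap.ker R) :=
    Φ.symm.conj.toLinearMap ∘ₗ WeylGNS.schroedingerLin n
  have hπ : ∀ f x, Φ (π f x) = WeylGNS.schroedinger f (Φ x) := fun f x =>
    Φ.apply_symm_apply _
  -- The inner product is the `L²` product pulled back along `Φ`, so it is well defined on the
  -- quotient from the start and only its agreement with the GNS pairing needs proof.
  refine ⟨LinearMap.ker R, ?_, hmem, fun f g hg => ?_, Φ,
    fun x y => WeylGNS.l2 (Φ x) (Φ y), π, hΦ, fun φ => ?_, fun g h => ?_, fun φ ψ => ?_,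
    fun f g => ?_, ?_, fun f g => ?_, fun f φ => ⟨?_, ?_⟩⟩
  · ext g
    change g ∈ LinearMap.ker R ↔ WeylGNS.gnsPairing g g = 0
    rw [hmem, WeylGNS.gnsPairing_eq_l2, WeylGNS.l2_self_eq_zero]
  · rw [hmem] at hg ⊢
    rw [WeylGNS.restrS_starZ, hg]
    exact map_zero (WeylGNS.schroedingerLin n f)
  · rw [LinearEquiv.symm_apply_eq, hΦ, WeylGNS.restrS_liftL]
  · simp only [hΦ, WeylGNS.gnsPairing_eq_l2]
  · simp only [LinearEquiv.apply_symm_apply]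
  · exact Φ.injective (by rw [hπ, hΦ, hΦ, WeylGNS.restrS_starZ])
  · refine LinearMap.ext fun x => Φ.injective ?_
    rw [hπ, WeylGNS.schroedinger_one, Module.End.one_apply]
  · refine LinearMap.ext fun x => Φ.injective ?_
    rw [hπ, WeylGNS.schroedinger_star, Module.End.mul_apply, hπ, hπ]
  · rw [hπ, LinearEquiv.apply_symm_apply, WeylGNS.restrS_starZ, WeylGNS.restrS_liftL]
  · rw [hπ, LinearEquiv.apply_symm_apply]
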